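/- Consider a chain of $2n=2b+L$ spins with local basis states $u,0,d$, identified with lattice steps $+1,0,-1$, so that basis states of $k$ spins are paths of $k$ steps. A Motzkin walk is a path from height $0$ to height $0$ that never goes below height $0$. The Motzkin state $|\mathcal M_{2n}\rangle$ is the normalized uniform superposition of all Motzkin walks on $2n$ steps. Let $\rho_{b,L}$ be the reduced density matrix, in this state, of the $L$ middle spins (the first $b$ and the last $b$ spins are traced out). For $|p|\le L$ let $|C_{L,p}\rangle$ be the normalized uniform superposition of all paths of $L$ steps with total displacement $p$ (with no sign constraint on the height), and let $$g_{L,p}=\frac{\exp\left(-\frac{3p^2}{4L}\right)}{\sum_{q=-L}^{L}\exp\left(-\frac{3q^2}{4L}\right)} .$$ Write $S(\rho)=-\mathrm{Tr}(\rho\log\rho)$ and $S^\kappa(\rho)=\frac1{1-\kappa}\log\mathrm{Tr}(\rho^\kappa)$ for $\kappa>0$, $\kappa\neq1$, with natural logarithms. The regime $1\ll L\ll n$ is understood as the iterated limit in which first $n\to\infty$ (that is, $b\to\infty$) with $L$ fixed, and then $L\to\infty$. In this sense: 1. (Diagonalization.) For every $L$ the limit $\rho_L=\lim_{b\to\infty}\rho_{b,L}$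 exists, and $\rho_L=\sum_{p=-L}^{L}\lambda_{L,p}\,|C_{L,p}\rangle\langle C_{L,p}|$ with all $\lambda_{L,p}>0$. The weights are asymptotically Gaussian: as $L\to\infty$, $$\Big\|\rho_L-\sum_{p=-L}^{L}g_{L,p}\,|C_{L,p}\rangle\langle C_{L,p}|\Big\|_{1}\to0$$ in trace norm, and for every real $R$, $\lambda_{L,p}/g_{L,p}\to1$ uniformly over the integers $p$ with $|p|\le R\sqrt L$. 2. (Schmidt rank.) For every $L$, $\operatorname{rank}\rho_L=2L+1$. Moreover, there is $\delta_L>0$ such that for every $\varepsilon\in(0,\delta_L)$ and all sufficiently large $b$, exactly $2L+1$ eigenvalues of $\rho_{b,L}$, counted with multiplicity, exceed $\varepsilon$. 3. (von Neumann entropy.) For every $L$, $\lim_{b\to\infty}S(\rho_{b,L})=S(\rho_L)$, and $$S(\rho_L)=\tfrac12\log L+\log\left(2\sqrt{\tfrac{\pi}{3}}\right)+\tfrac12+o(1)\qquad(L\to\infty).$$ 4. (Rényi entropies.) For every $\kappa>0$, $\kappa\ne1$, and every $L$, $\lim_{b\to\infty}S^\kappa(\rho_{b,L})=S^\kappa(\rho_L)$,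 and $$S^\kappa(\rho_L)=\tfrac12\log L+\log\left(2\sqrt{\tfrac{\pi}{3}}\right)-\frac{\log\kappa}{2(1-\kappa)}+o(1)\qquad(L\to\infty).$$ -/

import Mathlib

open Filter Topology
open scoped Matrix

namespace MotzkinChain

/-- Configurations of `k` spins in the `s^z` basis. A local state is `1` (a step up, `u`), `0` (a
flat step) or `-1` (a step down, `d`), so a configuration is also a lattice path of `k` steps. -/
abbrev Config (k : ℕ) : Type := Fin k → SignType

/-- The height of the path after its first `j` steps, when it starts at height `0`. -/
def height {k : ℕ} (s : Config k) (j : ℕ) : ℤ :=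
  ∑ i : Fin k, if (i : ℕ) < j then ((s i : SignType) : ℤ) else 0

/-- The total displacement of a path. -/
def displacement {k : ℕ} (s : Config k) : ℤ := ∑ i : Fin k, ((s i : SignType) : ℤ)

/-- Motzkin walks: paths from height `0` to height `0` that never go below height `0`. -/
def IsMotzkin {k : ℕ} (s : Config k) : Prop :=
  (∀ j ≤ k, 0 ≤ height s j) ∧ displacement s = 0

/-- The number of Motzkin walks on `k` steps. -/
noncomputable def motzkinCount (k : ℕ) : ℕ := Nat.card {s : Config k // IsMotzkin s}

open Classical in
/-- The Motzkin state on `k` spins: the normalized uniform superposition of all Motzkin walks. -/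
noncomputable def motzkinState (k : ℕ) : Config k → ℂ := fun s =>
  if IsMotzkin s then ((1 / Real.sqrt (motzkinCount k) : ℝ) : ℂ) else 0

/-- The operator `|v⟩⟨v|`. -/
noncomputable def ketBra {ι : Type*} (v : ι → ℂ) : Matrix ι ι ℂ := Matrix.vecMulVec v (star v)

/-- The partial trace over the first `a` and the last `c` spins of a chain of `a + L + c` spins. -/
noncomputable def partialTrace (a L c : ℕ)
    (ρ : Matrix (Config (a + L + c)) (Config (a + L + c)) ℂ) : Matrix (Config L) (Config L) ℂ :=
  fun w w' => ∑ x : Config a, ∑ y : Config c,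
    ρ (Fin.append (Fin.append x w) y) (Fin.append (Fin.append x w') y)

/-- The reduced density matrix of the `L` middle spins in the Motzkin state of a chain of
`2n = b + L + b` spins. -/
noncomputable def blockDensity (b L : ℕ) : Matrix (Config L) (Config L) ℂ :=
  partialTrace b L b (ketBra (motzkinState (b + L + b)))

theorem blockDensity_isHermitian (b L : ℕ) : (blockDensity b L).IsHermitian := by
  ext w w'
  simp [blockDensity, partialTrace, ketBra, Matrix.vecMulVec_apply, mul_comm]

/-- The number `M_{L,p}` of paths of `L` steps with total displacement `p` (with no constraint on
the sign of the height). -/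
noncomputable def walkCount (L : ℕ) (p : ℤ) : ℕ :=
  Nat.card {w : Config L // displacement w = p}

/-- `|C_{L,p}⟩`: the normalized uniform superposition of all paths of `L` steps with total
displacement `p`. -/
noncomputable def walkState (L : ℕ) (p : ℤ) : Config L → ℂ := fun w =>
  if displacement w = p then ((1 / Real.sqrt (walkCount L p) : ℝ) : ℂ) else 0

/-- The Gaussian weight `exp (-3p²/(4L)) / ∑_{q=-L}^{L} exp (-3q²/(4L))`. -/
noncomputable def gaussWeight (L : ℕ) (p : ℤ) : ℝ :=
  Real.exp (-(3 / 4) * (p : ℝ) ^ 2 / L) /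
    ∑ q ∈ Finset.Icc (-(L : ℤ)) L, Real.exp (-(3 / 4) * (q : ℝ) ^ 2 / L)

/-- The operator `∑_{p=-L}^{L} c p |C_{L,p}⟩⟨C_{L,p}|`. -/
noncomputable def walkDiagonal (L : ℕ) (c : ℤ → ℝ) : Matrix (Config L) (Config L) ℂ :=
  ∑ p ∈ Finset.Icc (-(L : ℤ)) L, ((c p : ℝ) : ℂ) • ketBra (walkState L p)

/-- The trace norm `Tr √(Aᴴ A)`. -/
noncomputable def traceNorm {ι : Type*} [Fintype ι] [DecidableEq ι] (A : Matrix ι ι ℂ) : ℝ :=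
  (cfc Real.sqrt (Aᴴ * A)).trace.re

/-- The von Neumann entropy `-Tr (ρ log ρ)` in nats, where `0 log 0 = 0`. -/
noncomputable def vonNeumannEntropy {ι : Type*} [Fintype ι] [DecidableEq ι]
    (ρ : Matrix ι ι ℂ) : ℝ :=
  (cfc (fun x : ℝ => -(x * Real.log x)) ρ).trace.re

/-- The Rényi entropy `log (Tr ρ^κ) / (1 - κ)` in nats, for `κ > 0`, `κ ≠ 1`. -/
noncomputable def renyiEntropy {ι : Type*} [Fintype ι] [DecidableEq ι]
    (κ : ℝ) (ρ : Matrix ι ι ℂ) : ℝ :=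
  1 / (1 - κ) * Real.log (cfc (fun x : ℝ => x ^ κ) ρ).trace.re

end MotzkinChain

/-!
Tracing out the two ends of a Motzkin walk leaves, for block configurations `w`, `w'`, the number
of pairs of outer paths that complete both `w` and `w'` to Motzkin walks, divided by the number of
all Motzkin walks. The number of pairs is zero unless `w` and `w'` have the same displacement `p`,
in which case it is `∑ h, v h * v (h + p)`. Here `v h` counts the nonnegative paths of `b` steps
that end at height `h`, and `h` is restricted to starting heights at which neither path of the block
goes below zero (`blockDensity_apply`).

As `b → ∞` this quotient becomes the same for all pairs of equal displacement. The squared `ℓ²` norm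
of `v` is the Motzkin number `M (2b)`, and the squared distance of `v` from its translate by one is
`3 * M (2b) - M (2b+1)` (`shiftDefect_one`), which is of lower order because the ratio of
consecutive Motzkin numbers tends to `3` (`tendsto_ballot_ratio`). Hence `v` agrees with all its
translates to leading order and no fixed height carries a positive fraction of the norm, so that the
constraint at the bottom is void in the limit. The limit matrix has the entries `3 ^ (-L)` on pairs
of equal displacement (`tendsto_blockDensity`). It is diagonal in the vectors `|C_{L,p}⟩`, and its
eigenvalues are the probabilities `walkProb L p` that `L` independent uniform steps in `{-1, 0, 1}`
add up to `p`.

The traces of functions of a Hermitian matrix depend continuously on the matrix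
(`tendsto_trace_cfc`). This gives the limits of the entropies for fixed `L`, and, by means of
continuous functions on both sides of an indicator function, the number of eigenvalues above a small
threshold.

The asymptotics in `L` rest on two facts about `walkProb`: the local limit theorem
`abs_sqrt_mul_walkProb_sub_le`, uniform in `p`, which follows from the Fourier representation and
dominated convergence, and the bound `exists_walkProb_le` by `C / √L * exp (-|p| / (2 √L))`, which
combines unimodality with exponential moments. Together they make `1 / √L` times a sum over `p` of a
function of `√L * walkProb L p` a Riemann sum to which dominated convergence applies
(`tendsto_riemann_sum`). The trace norm and the two kinds of entropy are all of this form, and the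
constants are the entropies of the Gaussian density of variance `2/3`. The Motzkin ratio comes from
the same Fourier integrals, through the reflection principle `ballot_eq_walkCount_sub`.
-/

namespace MotzkinChain

/-! ### Traces of functions of Hermitian matrices -/

section Spectral

variable {ι : Type*} [Fintype ι] [DecidableEq ι]

theorem trace_cfc_eq_sum {A : Matrix ι ι ℂ} (hA : A.IsHermitian) (f : ℝ → ℝ) :
    (cfc f A).trace.re = ∑ i, f (hA.eigenvalues i) := by
  rw [hA.cfc_eq, Matrix.IsHermitian.cfc, Unitary.conjStarAlgAut_apply, Matrix.trace_mul_cycle]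
  simp [Matrix.trace_diagonal]

theorem trace_aeval_eq_sum {A : Matrix ι ι ℂ} (hA : A.IsHermitian) (q : Polynomial ℝ) :
    (Polynomial.aeval A q).trace.re = ∑ i, q.eval (hA.eigenvalues i) := by
  rw [← trace_cfc_eq_sum hA (fun x => q.eval x), cfc_polynomial q A hA.isSelfAdjoint]

/-- Functions of a Hermitian matrix depend continuously on the matrix, under the trace. On the
bounded interval that holds all the eigenvalues the function is uniformly close to a polynomial,
and for a polynomial the claim is the continuity of the matrix operations. -/
theorem tendsto_trace_cfc {A : ℕ → Matrix ι ι ℂ} {B : Matrix ι ι ℂ}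
    (hA : ∀ n, (A n).IsHermitian) (hB : B.IsHermitian) (h : Tendsto A atTop (𝓝 B))
    {f : ℝ → ℝ} (hf : Continuous f) :
    Tendsto (fun n => (cfc f (A n)).trace.re) atTop (𝓝 (cfc f B).trace.re) := by
  have hpoly : ∀ q : Polynomial ℝ, Tendsto (fun n => ∑ i, q.eval ((hA n).eigenvalues i)) atTop
      (𝓝 (∑ i, q.eval (hB.eigenvalues i))) := by
    intro q
    simp_rw [← trace_aeval_eq_sum]
    have hc : Continuous fun M : Matrix ι ι ℂ => (Polynomial.aeval M q).trace.re := by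
      refine Complex.continuous_re.comp (Continuous.matrix_trace ?_)
      simp_rw [Polynomial.aeval_eq_sum_range]
      exact continuous_finsetSum _ fun i _ => (continuous_pow i).const_smul (q.coeff i)
    exact (hc.tendsto B).comp h
  set K : ℝ := (∑ i, (hB.eigenvalues i) ^ 2) + 2 with hK
  have hK0 : 0 ≤ ∑ i, (hB.eigenvalues i) ^ 2 := Finset.sum_nonneg fun i _ => sq_nonneg _
  have hbd : ∀ᶠ n in atTop, ∀ i, (hA n).eigenvalues i ∈ Set.Icc (-K) K := by
    have h2 := hpoly (Polynomial.X ^ 2)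
    simp only [Polynomial.eval_pow, Polynomial.eval_X] at h2
    filter_upwards [h2.eventually (gt_mem_nhds (lt_add_one _))] with n hn i
    have h3 : (hA n).eigenvalues i ^ 2 ≤ ∑ i, (hA n).eigenvalues i ^ 2 :=
      Finset.single_le_sum (f := fun i => (hA n).eigenvalues i ^ 2) (fun i _ => sq_nonneg _)
        (Finset.mem_univ i)
    rw [Set.mem_Icc, ← abs_le]
    refine abs_le_of_sq_le_sq ?_ (by linarith)
    nlinarith
  have hbdB : ∀ i, hB.eigenvalues i ∈ Set.Icc (-K) K := by
    intro i
    have h3 : hB.eigenvalues i ^ 2 ≤ ∑ i, hB.eigenvalues i ^ 2 :=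
      Finset.single_le_sum (f := fun i => hB.eigenvalues i ^ 2) (fun i _ => sq_nonneg _)
        (Finset.mem_univ i)
    rw [Set.mem_Icc, ← abs_le]
    refine abs_le_of_sq_le_sq ?_ (by linarith)
    nlinarith
  simp_rw [fun n => trace_cfc_eq_sum (hA n) f, trace_cfc_eq_sum hB f]
  rw [Metric.tendsto_atTop']
  intro ε hε
  set N : ℝ := (Fintype.card ι : ℝ) with hN
  have hN0 : 0 ≤ N := Nat.cast_nonneg _
  set η : ℝ := ε / (3 * (N + 1)) with hη
  have hη0 : 0 < η := by positivity
  have hηN : N * η < ε / 3 := by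
    rw [hη, ← mul_div_assoc, div_lt_div_iff₀ (by positivity) (by norm_num)]
    nlinarith
  obtain ⟨q, hq⟩ := exists_polynomial_near_of_continuousOn (-K) K f hf.continuousOn η hη0
  have key : ∀ e : ι → ℝ, (∀ i, e i ∈ Set.Icc (-K) K) →
      |∑ i, q.eval (e i) - ∑ i, f (e i)| ≤ N * η := by
    intro e he
    rw [← Finset.sum_sub_distrib]
    refine (Finset.abs_sum_le_sum_abs _ _).trans ?_
    refine (Finset.sum_le_sum fun i _ => (hq (e i) (he i)).le).trans ?_
    simp [hN]
  have h4 := (hpoly q).eventually (Metric.ball_mem_nhds _ (show 0 < ε / 3 by positivity))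
  obtain ⟨n0, hn0⟩ := (hbd.and h4).exists_forall_of_atTop
  refine ⟨n0, fun n hn => ?_⟩
  obtain ⟨h5, h6⟩ := hn0 n hn.le
  have h7 := key _ h5
  have h8 := key _ hbdB
  rw [Real.dist_eq] at h6 ⊢
  rw [abs_le] at h7 h8
  rw [abs_lt] at h6 ⊢
  constructor <;> linarith

/-- If the powers of a Hermitian matrix have the same traces as those of a diagonal matrix with
entries `c`, the matrix has the eigenvalues `c`, apart from the eigenvalue `0`. -/
theorem sum_eigenvalues_eq_of_trace_pow {A : Matrix ι ι ℂ} (hA : A.IsHermitian) {κ : Type*}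
    (s : Finset κ) (c : κ → ℝ) (h : ∀ n : ℕ, (A ^ (n + 1)).trace = ∑ p ∈ s, ((c p : ℝ) : ℂ) ^ (n + 1))
    {f : ℝ → ℝ} (hf : f 0 = 0) :
    ∑ i, f (hA.eigenvalues i) = ∑ p ∈ s, f (c p) := by
  classical
  -- by linearity the claim holds for all polynomials without constant term
  have hpoly : ∀ q : Polynomial ℝ, ∑ i, (Polynomial.X * q).eval (hA.eigenvalues i)
      = ∑ p ∈ s, (Polynomial.X * q).eval (c p) := by
    intro q
    induction q using Polynomial.induction_on' with
    | add q r hq hr =>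
      simp only [mul_add, Polynomial.eval_add, Finset.sum_add_distrib, hq, hr]
    | monomial n a =>
      have h1 : Polynomial.X * Polynomial.monomial n a
          = Polynomial.C a * Polynomial.X ^ (n + 1) := by
        rw [← Polynomial.C_mul_X_pow_eq_monomial]; ring
      have h2 := trace_aeval_eq_sum hA (Polynomial.X ^ (n + 1))
      simp only [map_pow, Polynomial.aeval_X, h, Polynomial.eval_pow, Polynomial.eval_X] at h2
      simp only [h1, Polynomial.eval_mul, Polynomial.eval_C, Polynomial.eval_pow,
        Polynomial.eval_X, ← Finset.mul_sum, ← h2]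
      congr 1
      rw [Complex.re_sum]
      refine Finset.sum_congr rfl fun p _ => ?_
      rw [← Complex.ofReal_pow, Complex.ofReal_re]
  -- and `f` agrees with such a polynomial on the finite set of all values that occur
  set T : Finset ℝ := insert 0 (Finset.univ.image hA.eigenvalues ∪ s.image c) with hT
  set q := Lagrange.interpolate T id f with hq
  have hev : ∀ x ∈ T, q.eval x = f x := fun x hx =>
    Lagrange.eval_interpolate_at_node f (Function.injective_id.injOn) hx
  have h0 : q.eval 0 = 0 := by rw [hev 0 (by simp [hT]), hf]
  obtain ⟨r, hr⟩ : Polynomial.X ∣ q := by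
    rw [Polynomial.X_dvd_iff, Polynomial.coeff_zero_eq_eval_zero, h0]
  calc ∑ i, f (hA.eigenvalues i) = ∑ i, q.eval (hA.eigenvalues i) :=
        Finset.sum_congr rfl fun i _ => (hev _ (by simp [hT])).symm
    _ = ∑ p ∈ s, q.eval (c p) := by rw [hr]; exact hpoly r
    _ = ∑ p ∈ s, f (c p) :=
        Finset.sum_congr rfl fun p hp => hev _ (by
          simp only [hT, Finset.mem_insert, Finset.mem_union, Finset.mem_image]
          exact Or.inr (Or.inr ⟨p, hp, rfl⟩))

end Spectral

/-! ### Operators diagonal in the vectors `|C_{L,p}⟩` -/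

theorem abs_displacement_le {L : ℕ} (w : Config L) : |displacement w| ≤ L := by
  refine (Finset.abs_sum_le_sum_abs _ _).trans ?_
  refine (Finset.sum_le_sum (g := fun _ => 1) fun i _ => ?_).trans (by simp)
  cases w i <;> simp

theorem displacement_mem_Icc {L : ℕ} (w : Config L) :
    displacement w ∈ Finset.Icc (-(L : ℤ)) L := by
  rw [Finset.mem_Icc]; exact abs_le.mp (abs_displacement_le w)

theorem walkCount_eq_card (L : ℕ) (p : ℤ) :
    walkCount L p = (Finset.univ.filter fun w : Config L => displacement w = p).card := by
  rw [walkCount, Nat.card_eq_fintype_card, Fintype.card_subtype]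

theorem walkCount_displacement_pos {L : ℕ} (w : Config L) : 0 < walkCount L (displacement w) := by
  rw [walkCount_eq_card, Finset.card_pos]; exact ⟨w, by simp⟩

theorem ketBra_walkState_apply (L : ℕ) (p : ℤ) (w w' : Config L) :
    ketBra (walkState L p) w w' =
      if displacement w = p ∧ displacement w' = p then ((1 / walkCount L p : ℝ) : ℂ) else 0 := by
  rw [ketBra, Matrix.vecMulVec_apply, Pi.star_apply, walkState, walkState]
  by_cases h : displacement w = p <;> by_cases h' : displacement w' = p <;> simp [h, h']
  rw [← mul_inv, ← Complex.ofReal_mul, Real.mul_self_sqrt (Nat.cast_nonneg _)]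
  simp

theorem walkDiagonal_apply (L : ℕ) (c : ℤ → ℝ) (w w' : Config L) :
    walkDiagonal L c w w' = if displacement w = displacement w' then
      ((c (displacement w) / walkCount L (displacement w) : ℝ) : ℂ) else 0 := by
  rw [walkDiagonal, Matrix.sum_apply]
  simp only [Matrix.smul_apply, ketBra_walkState_apply, smul_eq_mul]
  rw [Finset.sum_eq_single (displacement w)]
  · by_cases h : displacement w = displacement w'
    · simp [h, div_eq_mul_inv]
    · simp [h, Ne.symm h]
  · intro p _ hp; simp [Ne.symm hp]
  · intro h; exact absurd (displacement_mem_Icc w) h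

theorem walkDiagonal_isHermitian (L : ℕ) (c : ℤ → ℝ) : (walkDiagonal L c).IsHermitian := by
  ext w w'
  rw [Matrix.conjTranspose_apply, walkDiagonal_apply, walkDiagonal_apply]
  by_cases h : displacement w = displacement w'
  · simp [h]
  · simp [h, Ne.symm h]

theorem walkDiagonal_mul (L : ℕ) (c d : ℤ → ℝ) :
    walkDiagonal L c * walkDiagonal L d = walkDiagonal L fun p => c p * d p := by
  ext w w'
  rw [Matrix.mul_apply]
  simp only [walkDiagonal_apply]
  have hpos : (0 : ℝ) < walkCount L (displacement w) := by
    exact_mod_cast walkCount_displacement_pos w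
  have hne : (walkCount L (displacement w) : ℂ) ≠ 0 := by exact_mod_cast hpos.ne'
  by_cases h : displacement w = displacement w'
  · rw [if_pos h]
    have : ∀ x : Config L, ((if displacement w = displacement x then
        ((c (displacement w) / walkCount L (displacement w) : ℝ) : ℂ) else 0) *
        if displacement x = displacement w' then
        ((d (displacement x) / walkCount L (displacement x) : ℝ) : ℂ) else 0) =
        if displacement x = displacement w then ((c (displacement w) * d (displacement w) /
          walkCount L (displacement w) ^ 2 : ℝ) : ℂ) else 0 := by
      intro x
      by_cases hx : displacement x = displacement w
      · rw [if_pos hx.symm, if_pos (hx.trans h), if_pos hx, hx]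
        push_cast; field_simp
      · rw [if_neg (Ne.symm hx), if_neg hx, zero_mul]
    rw [Finset.sum_congr rfl fun x _ => this x, Finset.sum_ite, Finset.sum_const,
      ← walkCount_eq_card]
    simp
    field_simp
  · rw [if_neg h]
    refine Finset.sum_eq_zero fun x _ => ?_
    by_cases hx : displacement w = displacement x
    · rw [if_neg (fun h' => h (hx.trans h')), mul_zero]
    · rw [if_neg hx, zero_mul]

theorem walkDiagonal_pow (L : ℕ) (c : ℤ → ℝ) (n : ℕ) :
    walkDiagonal L c ^ (n + 1) = walkDiagonal L fun p => c p ^ (n + 1) := by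
  induction n with
  | zero => simp
  | succ n ih => rw [pow_succ, ih, walkDiagonal_mul]; rfl

theorem walkDiagonal_sub (L : ℕ) (c d : ℤ → ℝ) :
    walkDiagonal L c - walkDiagonal L d = walkDiagonal L fun p => c p - d p := by
  simp [walkDiagonal, ← Finset.sum_sub_distrib, sub_smul]

theorem walkCount_pos {L : ℕ} {p : ℤ} (hp : |p| ≤ L) : 0 < walkCount L p := by
  -- the first `|p|` steps go in the direction of `p`, the others are flat
  have h : displacement (fun i : Fin L => if (i : ℕ) < p.natAbs then SignType.sign p else 0) = p := by
    have hp' : p.natAbs ≤ L := by rw [Int.abs_eq_natAbs] at hp; omega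
    have h1 : ∀ i : Fin L, (((if (i : ℕ) < p.natAbs then SignType.sign p else 0 : SignType)) : ℤ)
        = if (i : ℕ) < p.natAbs then ((SignType.sign p : SignType) : ℤ) else 0 := by
      intro i; split_ifs <;> simp
    rw [displacement, Finset.sum_congr rfl fun i _ => h1 i,
      Fin.sum_univ_eq_sum_range (fun i => if i < p.natAbs then ((SignType.sign p : SignType) : ℤ)
        else 0) L, ← Finset.sum_filter, Finset.sum_const]
    have h2 : (Finset.range L).filter (· < p.natAbs) = Finset.range p.natAbs := by
      ext i; simp only [Finset.mem_filter, Finset.mem_range]; omega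
    rw [h2, Finset.card_range, nsmul_eq_mul]
    rcases lt_trichotomy p 0 with h | h | h
    · simp [h, abs_of_neg h]
    · simp [h]
    · simp [h, abs_of_pos h]
  rw [← h]
  exact walkCount_displacement_pos _

theorem trace_walkDiagonal (L : ℕ) (c : ℤ → ℝ) :
    (walkDiagonal L c).trace = ∑ p ∈ Finset.Icc (-(L : ℤ)) L, ((c p : ℝ) : ℂ) := by
  rw [Matrix.trace, ← Finset.sum_fiberwise_of_maps_to (t := Finset.Icc (-(L : ℤ)) L)
    (g := displacement) fun w _ => displacement_mem_Icc w]
  refine Finset.sum_congr rfl fun p hp => ?_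
  have hpos : (walkCount L p : ℂ) ≠ 0 := by
    exact_mod_cast (walkCount_pos (abs_le.mpr (Finset.mem_Icc.mp hp))).ne'
  rw [Finset.sum_congr rfl (g := fun _ => ((c p / walkCount L p : ℝ) : ℂ)), Finset.sum_const,
    ← walkCount_eq_card]
  · simp; field_simp
  · intro w hw
    rw [Matrix.diag_apply, walkDiagonal_apply, if_pos rfl, (Finset.mem_filter.mp hw).2]

theorem sum_eigenvalues_walkDiagonal (L : ℕ) (c : ℤ → ℝ) {A : Matrix (Config L) (Config L) ℂ}
    (hA : A.IsHermitian) (h : A = walkDiagonal L c) {f : ℝ → ℝ} (hf : f 0 = 0) :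
    ∑ i, f (hA.eigenvalues i) = ∑ p ∈ Finset.Icc (-(L : ℤ)) L, f (c p) := by
  refine sum_eigenvalues_eq_of_trace_pow hA _ c (fun n => ?_) hf
  rw [h, walkDiagonal_pow, trace_walkDiagonal]
  simp

theorem trace_cfc_walkDiagonal (L : ℕ) (c : ℤ → ℝ) {f : ℝ → ℝ} (hf : f 0 = 0) :
    (cfc f (walkDiagonal L c)).trace.re = ∑ p ∈ Finset.Icc (-(L : ℤ)) L, f (c p) := by
  rw [trace_cfc_eq_sum (walkDiagonal_isHermitian L c),
    sum_eigenvalues_walkDiagonal L c (walkDiagonal_isHermitian L c) rfl hf]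

theorem traceNorm_walkDiagonal (L : ℕ) (c : ℤ → ℝ) :
    traceNorm (walkDiagonal L c) = ∑ p ∈ Finset.Icc (-(L : ℤ)) L, |c p| := by
  rw [traceNorm, (walkDiagonal_isHermitian L c).eq, walkDiagonal_mul,
    trace_cfc_walkDiagonal L _ Real.sqrt_zero]
  simp [Real.sqrt_mul_self_eq_abs]

theorem rank_walkDiagonal (L : ℕ) (c : ℤ → ℝ) (hc : ∀ p : ℤ, |p| ≤ L → 0 < c p) :
    (walkDiagonal L c).rank = 2 * L + 1 := by
  classical
  have hA := walkDiagonal_isHermitian L c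
  have h := sum_eigenvalues_walkDiagonal L c hA rfl (f := fun x => if x ≠ 0 then 1 else 0)
    (by simp)
  rw [hA.rank_eq_card_non_zero_eigs, Fintype.card_subtype]
  rw [Finset.sum_congr rfl (s₁ := Finset.Icc (-(L : ℤ)) L) (g := fun _ => (1 : ℝ)) fun p hp =>
    if_pos (hc p (abs_le.mpr (Finset.mem_Icc.mp hp))).ne'] at h
  simp only [Finset.sum_boole, Finset.sum_const, Int.card_Icc, nsmul_eq_mul, mul_one] at h
  have h' := Nat.cast_injective h
  rw [h']; omega

/-- The number of eigenvalues above a small threshold is stable under perturbation: it is bounded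
on both sides by traces of continuous functions of the matrix. -/
theorem eventually_card_eigenvalues_gt (L : ℕ) (c : ℤ → ℝ)
    {A : ℕ → Matrix (Config L) (Config L) ℂ} (hA : ∀ n, (A n).IsHermitian)
    (h : Tendsto A atTop (𝓝 (walkDiagonal L c))) {δ ε : ℝ} (hc : ∀ p : ℤ, |p| ≤ L → δ ≤ c p)
    (hε : 0 < ε) (hεδ : ε < δ) :
    ∀ᶠ n in atTop, Nat.card {w : Config L // ε < (hA n).eigenvalues w} = 2 * L + 1 := by
  classical
  have hlim : ∀ f : ℝ → ℝ, Continuous f → f 0 = 0 → (∀ x, δ ≤ x → f x = 1) →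
      Tendsto (fun n => ∑ i, f ((hA n).eigenvalues i)) atTop (𝓝 ((2 * L + 1 : ℕ) : ℝ)) := by
    intro f hf h0 h1
    have h2 := tendsto_trace_cfc hA (walkDiagonal_isHermitian L c) h hf
    rw [trace_cfc_walkDiagonal L c h0, Finset.sum_congr rfl fun p hp =>
      h1 _ (hc p (abs_le.mpr (Finset.mem_Icc.mp hp)))] at h2
    simp_rw [fun n => trace_cfc_eq_sum (hA n) f] at h2
    convert h2 using 2
    simp only [Finset.sum_const, Int.card_Icc, nsmul_eq_mul, mul_one, Nat.cast_inj]
    omega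
  -- piecewise linear functions below and above the indicator function of `(ε, ∞)`
  have hlow := hlim (fun x => min 1 (max 0 ((x - ε) / (δ - ε)))) (by fun_prop)
    (by
      have : (0 - ε) / (δ - ε) ≤ 0 := div_nonpos_of_nonpos_of_nonneg (by linarith) (by linarith)
      simp only [max_eq_left this]; simp)
    (fun x hx => by
      have : 1 ≤ (x - ε) / (δ - ε) := by rw [le_div_iff₀ (by linarith)]; linarith
      exact min_eq_left (this.trans (le_max_right _ _)))
  have hup := hlim (fun x => min 1 (max 0 (x / ε))) (by fun_prop) (by simp)
    (fun x hx => by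
      have : 1 ≤ x / ε := by rw [le_div_iff₀ hε]; linarith
      exact min_eq_left (this.trans (le_max_right _ _)))
  filter_upwards [hlow.eventually (lt_mem_nhds (sub_one_lt _)),
    hup.eventually (gt_mem_nhds (lt_add_one _))] with n hn1 hn2
  have hcard : (Nat.card {w : Config L // ε < (hA n).eigenvalues w} : ℝ)
      = ∑ i, if ε < (hA n).eigenvalues i then (1 : ℝ) else 0 := by
    rw [Nat.card_eq_fintype_card, Fintype.card_subtype, Finset.sum_boole]
  have h1 : ((2 * L + 1 : ℕ) : ℝ) - 1 < Nat.card {w : Config L // ε < (hA n).eigenvalues w} := by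
    refine hn1.trans_le ?_
    rw [hcard]
    refine Finset.sum_le_sum fun i _ => ?_
    split_ifs with hi
    · exact min_le_left _ _
    · have : ((hA n).eigenvalues i - ε) / (δ - ε) ≤ 0 :=
        div_nonpos_of_nonpos_of_nonneg (by linarith) (by linarith)
      simp only [max_eq_left this]; simp
  have h2 : (Nat.card {w : Config L // ε < (hA n).eigenvalues w} : ℝ) < (2 * L + 1 : ℕ) + 1 := by
    refine lt_of_le_of_lt ?_ hn2
    rw [hcard]
    refine Finset.sum_le_sum fun i _ => ?_
    split_ifs with hi
    · have : 1 ≤ (hA n).eigenvalues i / ε := by rw [le_div_iff₀ hε]; linarith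
      exact le_min le_rfl (this.trans (le_max_right _ _))
    · exact le_min zero_le_one (le_max_left _ _)
  have h3 : 2 * L + 1 < Nat.card {w : Config L // ε < (hA n).eigenvalues w} + 1 := by
    have : ((2 * L + 1 : ℕ) : ℝ) < Nat.card {w : Config L // ε < (hA n).eigenvalues w} + 1 := by
      linarith
    exact_mod_cast this
  have h4 : Nat.card {w : Config L // ε < (hA n).eigenvalues w} < 2 * L + 1 + 1 := by
    exact_mod_cast h2
  omega

/-! ### Counting paths -/

/-- The number of paths of `k` steps from height `0` to height `h` that never go below height `0`,
through the recursion over the last step. -/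
def ballot : ℕ → ℤ → ℕ
  | 0, h => if h = 0 then 1 else 0
  | k + 1, h => if 0 ≤ h then ballot k (h - 1) + ballot k h + ballot k (h + 1) else 0

/-- The path `w`, started at height `h`, never goes below height `0`. -/
def StaysNonneg {k : ℕ} (h : ℤ) (w : Config k) : Prop := ∀ j ≤ k, 0 ≤ h + height w j

@[simp] theorem height_zero {k : ℕ} (w : Config k) : height w 0 = 0 := by simp [height]

theorem height_of_le {k j : ℕ} (w : Config k) (h : k ≤ j) : height w j = displacement w := by
  refine Finset.sum_congr rfl fun i _ => if_pos ?_
  omega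

theorem height_append {a c : ℕ} (x : Config a) (y : Config c) (j : ℕ) :
    height (Fin.append x y) j = height x j + height y (j - a) := by
  rw [height, Fin.sum_univ_add, height, height]
  congr 1
  · simp
  · refine Finset.sum_congr rfl fun i _ => ?_
    rw [Fin.append_right]
    refine if_congr ?_ rfl rfl
    simp only [Fin.val_natAdd]
    omega

theorem displacement_append {a c : ℕ} (x : Config a) (y : Config c) :
    displacement (Fin.append x y) = displacement x + displacement y := by
  simp [displacement, Fin.sum_univ_add]

theorem staysNonneg_append {a c : ℕ} (h : ℤ) (x : Config a) (y : Config c) :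
    StaysNonneg h (Fin.append x y) ↔ StaysNonneg h x ∧ StaysNonneg (h + displacement x) y := by
  constructor
  · intro H
    refine ⟨fun j hj => ?_, fun j hj => ?_⟩
    · have := H j (by omega)
      rwa [height_append, Nat.sub_eq_zero_of_le hj, height_zero, add_zero] at this
    · have := H (a + j) (by omega)
      rwa [height_append, height_of_le x (by omega), Nat.add_sub_cancel_left, ← add_assoc] at this
  · rintro ⟨H1, H2⟩ j hj
    rw [height_append]
    rcases le_total j a with hja | hja
    · rw [Nat.sub_eq_zero_of_le hja, height_zero, add_zero]; exact H1 j hja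
    · rw [height_of_le x hja, ← add_assoc]; exact H2 _ (by omega)

theorem isMotzkin_iff {k : ℕ} (w : Config k) :
    IsMotzkin w ↔ StaysNonneg 0 w ∧ displacement w = 0 := by
  simp [IsMotzkin, StaysNonneg]

theorem displacement_cons {k : ℕ} (s : SignType) (y : Config k) :
    displacement (Fin.cons s y : Config (k + 1)) = (s : ℤ) + displacement y := by
  simp [displacement, Fin.sum_univ_succ]

theorem displacement_snoc {k : ℕ} (s : SignType) (y : Config k) :
    displacement (Fin.snoc y s : Config (k + 1)) = displacement y + (s : ℤ) := by
  simp [displacement, Fin.sum_univ_castSucc]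

theorem staysNonneg_cons {k : ℕ} (h : ℤ) (s : SignType) (y : Config k) :
    StaysNonneg h (Fin.cons s y : Config (k + 1)) ↔ 0 ≤ h ∧ StaysNonneg (h + s) y := by
  have hs : ∀ j, height (Fin.cons s y : Config (k + 1)) (j + 1) = s + height y j := by
    intro j; simp [height, Fin.sum_univ_succ]
  constructor
  · intro H
    refine ⟨by simpa using H 0 (by omega), fun j hj => ?_⟩
    have := H (j + 1) (by omega)
    rwa [hs, ← add_assoc] at this
  · rintro ⟨H1, H2⟩ j hj
    cases j with
    | zero => simpa using H1
    | succ j => rw [hs, ← add_assoc]; exact H2 j (by omega)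

theorem staysNonneg_snoc {k : ℕ} (h : ℤ) (s : SignType) (y : Config k) :
    StaysNonneg h (Fin.snoc y s : Config (k + 1)) ↔
      StaysNonneg h y ∧ 0 ≤ h + displacement y + s := by
  have hs : ∀ j ≤ k, height (Fin.snoc y s : Config (k + 1)) j = height y j := by
    intro j hj
    simp [height, Fin.sum_univ_castSucc, Nat.not_lt.mpr hj]
  constructor
  · intro H
    refine ⟨fun j hj => ?_, ?_⟩
    · rw [← hs j hj]; exact H j (by omega)
    · have := H (k + 1) le_rfl
      rwa [height_of_le _ le_rfl, displacement_snoc, ← add_assoc] at this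
  · rintro ⟨H1, H2⟩ j hj
    rcases Nat.lt_or_ge k j with hkj | hkj
    · rw [height_of_le _ hkj, displacement_snoc, ← add_assoc]; exact H2
    · rw [hs j hkj]; exact H1 j hkj

theorem sum_config_cons {k : ℕ} {M : Type*} [AddCommMonoid M] (f : Config (k + 1) → M) :
    ∑ w, f w = ∑ y : Config k, (f (Fin.cons (-1) y) + f (Fin.cons 0 y) + f (Fin.cons 1 y)) := by
  rw [← (Fin.consEquiv fun _ : Fin (k + 1) => SignType).sum_comp, Fintype.sum_prod_type_right]
  refine Finset.sum_congr rfl fun y _ => ?_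
  have : (Finset.univ : Finset SignType) = {-1, 0, 1} := by decide
  rw [this]
  simp [Fin.consEquiv, add_assoc]

theorem sum_config_snoc {k : ℕ} {M : Type*} [AddCommMonoid M] (f : Config (k + 1) → M) :
    ∑ w, f w = ∑ y : Config k, (f (Fin.snoc y (-1)) + f (Fin.snoc y 0) + f (Fin.snoc y 1)) := by
  rw [← (Fin.snocEquiv fun _ : Fin (k + 1) => SignType).sum_comp, Fintype.sum_prod_type_right]
  refine Finset.sum_congr rfl fun y _ => ?_
  have : (Finset.univ : Finset SignType) = {-1, 0, 1} := by decide
  rw [this]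
  simp [Fin.snocEquiv, add_assoc]

open Classical in
/-- Right part of a Motzkin walk: paths that descend from height `h` to height `0`. -/
theorem sum_staysNonneg_descending (k : ℕ) (h : ℤ) :
    ∑ y : Config k, (if StaysNonneg h y ∧ h + displacement y = 0 then 1 else 0) = ballot k h := by
  induction k generalizing h with
  | zero =>
    rw [Fintype.sum_unique]
    simp only [StaysNonneg, displacement, height, ballot, Finset.univ_eq_empty, Finset.sum_empty,
      add_zero]
    refine if_congr ⟨fun H => H.2, fun H => ⟨fun _ _ => H.ge, H⟩⟩ rfl rfl
  | succ k ih =>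
    rw [sum_config_cons, ballot]
    simp only [staysNonneg_cons, displacement_cons, Finset.sum_add_distrib, ← add_assoc]
    split_ifs with h0
    · simp only [h0, true_and, ih]
      simp [sub_eq_add_neg]
    · simp [h0]

open Classical in
/-- Left part of a Motzkin walk: paths that ascend from height `0` to height `h`. -/
theorem sum_staysNonneg_ascending (k : ℕ) (h : ℤ) :
    ∑ x : Config k, (if StaysNonneg 0 x ∧ displacement x = h then 1 else 0) = ballot k h := by
  induction k generalizing h with
  | zero =>
    rw [Fintype.sum_unique]
    simp only [StaysNonneg, displacement, height, ballot, Finset.univ_eq_empty, Finset.sum_empty,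
      add_zero, le_refl, implies_true, true_and, eq_comm (a := (0 : ℤ))]
  | succ k ih =>
    rw [sum_config_snoc, ballot]
    simp only [staysNonneg_snoc, displacement_snoc, Finset.sum_add_distrib, zero_add]
    have hstep : ∀ s : SignType, (∑ x : Config k, if (StaysNonneg 0 x ∧ 0 ≤ displacement x + s) ∧
        displacement x + s = h then 1 else 0) = if 0 ≤ h then ballot k (h - s) else 0 := by
      intro s
      split_ifs with h0
      · rw [← ih]
        refine Finset.sum_congr rfl fun x _ => if_congr ?_ rfl rfl
        constructor
        · rintro ⟨⟨a, b⟩, c⟩; exact ⟨a, by omega⟩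
        · rintro ⟨a, b⟩; exact ⟨⟨a, by omega⟩, by omega⟩
      · refine Finset.sum_eq_zero fun x _ => if_neg ?_
        rintro ⟨⟨_, h1⟩, h2⟩; omega
    rw [hstep, hstep, hstep]
    split_ifs with h0
    · simp; omega
    · rfl

theorem motzkinCount_eq_ballot (k : ℕ) : motzkinCount k = ballot k 0 := by
  classical
  rw [motzkinCount, Nat.card_eq_fintype_card, Fintype.card_subtype, ← sum_staysNonneg_descending,
    Finset.card_filter]
  refine Finset.sum_congr rfl fun w _ => if_congr ?_ rfl rfl
  rw [isMotzkin_iff, zero_add]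

theorem ballot_eq_zero_of_neg (k : ℕ) {h : ℤ} (hh : h < 0) : ballot k h = 0 := by
  cases k with
  | zero => exact if_neg hh.ne
  | succ k => exact if_neg (not_le.mpr hh)

theorem ballot_eq_zero_of_lt {k : ℕ} {h : ℤ} (hh : k < h) : ballot k h = 0 := by
  induction k generalizing h with
  | zero => exact if_neg (by push_cast at hh; omega)
  | succ k ih =>
    push_cast at hh
    rw [ballot, ih (by omega), ih (by omega), ih (by omega)]; simp

theorem ballot_pos (k : ℕ) : 0 < ballot k 0 := by
  induction k with
  | zero => simp [ballot]
  | succ k ih => rw [ballot]; simp; omega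

open Classical in
/-- The reduced density matrix in terms of the numbers of left and right parts. The summation
index `h` is the height at which the block starts. -/
theorem blockDensity_apply (b L : ℕ) (w w' : Config L) :
    blockDensity b L w w' = if displacement w = displacement w' then
      (((∑ h ∈ Finset.Icc (-(b : ℤ)) b, if StaysNonneg h w ∧ StaysNonneg h w' then
        (ballot b h : ℝ) * ballot b (h + displacement w) else 0) / ballot (b + L + b) 0 : ℝ) : ℂ)
      else 0 := by
  set M := motzkinCount (b + L + b) with hM
  have hsplit : ∀ (x : Config b) (v : Config L) (y : Config b),
      IsMotzkin (Fin.append (Fin.append x v) y) ↔ StaysNonneg 0 x ∧ StaysNonneg (displacement x) v ∧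
        StaysNonneg (displacement x + displacement v) y ∧
          displacement x + displacement v + displacement y = 0 := by
    intro x v y
    rw [isMotzkin_iff, staysNonneg_append, staysNonneg_append, displacement_append,
      displacement_append, zero_add, zero_add,
      displacement_append, and_assoc, and_assoc]
  have hentry : blockDensity b L w w' = ∑ x : Config b, ∑ y : Config b,
      if IsMotzkin (Fin.append (Fin.append x w) y) ∧ IsMotzkin (Fin.append (Fin.append x w') y)
        then ((1 / M : ℝ) : ℂ) else 0 := by
    rw [blockDensity, partialTrace]
    refine Finset.sum_congr rfl fun x _ => Finset.sum_congr rfl fun y _ => ?_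
    rw [ketBra, Matrix.vecMulVec_apply, Pi.star_apply, motzkinState, motzkinState, ite_and]
    split_ifs
    · simp only [Complex.star_def, Complex.conj_ofReal]
      rw [← Complex.ofReal_mul, ← hM, div_mul_div_comm, one_mul,
        Real.mul_self_sqrt (Nat.cast_nonneg _)]
    all_goals simp
  rw [hentry]
  split_ifs with hp
  · have hinner : ∀ x : Config b, (∑ y : Config b, if IsMotzkin (Fin.append (Fin.append x w) y) ∧
        IsMotzkin (Fin.append (Fin.append x w') y) then ((1 / M : ℝ) : ℂ) else 0) =
        ∑ h ∈ Finset.Icc (-(b : ℤ)) b, if StaysNonneg 0 x ∧ displacement x = h then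
          (if StaysNonneg h w ∧ StaysNonneg h w' then
            ((ballot b (h + displacement w) / M : ℝ) : ℂ) else 0) else 0 := by
      intro x
      rw [Finset.sum_eq_single (displacement x)]
      · by_cases h1 : StaysNonneg 0 x ∧ StaysNonneg (displacement x) w ∧
            StaysNonneg (displacement x) w'
        · obtain ⟨h1, h2, h3⟩ := h1
          simp only [hsplit, ← hp, h1, h2, h3, true_and, and_self, if_true]
          rw [← sum_staysNonneg_descending]
          push_cast
          rw [Finset.sum_div]
          refine Finset.sum_congr rfl fun y _ => ?_
          split_ifs <;> simp
        · have h2 : ∀ y : Config b, ¬ (IsMotzkin (Fin.append (Fin.append x w) y) ∧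
              IsMotzkin (Fin.append (Fin.append x w') y)) := by
            intro y; rw [hsplit, hsplit]; tauto
          rw [Finset.sum_eq_zero fun y _ => if_neg (h2 y)]
          split_ifs <;> first | rfl | tauto
      · intro h _ hne; rw [if_neg]; rintro ⟨_, h2⟩; exact hne h2.symm
      · intro h; exact absurd (displacement_mem_Icc x) h
    rw [Finset.sum_congr rfl fun x _ => hinner x, Finset.sum_comm, Finset.sum_div,
      Complex.ofReal_sum]
    refine Finset.sum_congr rfl fun h _ => ?_
    rw [← motzkinCount_eq_ballot, ← hM]
    split_ifs with hh
    · have := sum_staysNonneg_ascending b h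
      rw [← this]
      push_cast
      rw [Finset.sum_mul, Finset.sum_div]
      refine Finset.sum_congr rfl fun x _ => ?_
      split_ifs <;> simp
    · simp
  · refine Finset.sum_eq_zero fun x _ => Finset.sum_eq_zero fun y _ => if_neg ?_
    rw [hsplit, hsplit]
    rintro ⟨⟨_, _, _, h1⟩, ⟨_, _, _, h2⟩⟩
    exact hp (by omega)

/-! ### Unconstrained paths and the reflection principle -/

theorem walkCount_zero (p : ℤ) : walkCount 0 p = if p = 0 then 1 else 0 := by
  rw [walkCount_eq_card, Finset.card_filter, Fintype.sum_unique]
  simp [displacement, eq_comm]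

theorem walkCount_succ (k : ℕ) (p : ℤ) :
    walkCount (k + 1) p = walkCount k (p - 1) + walkCount k p + walkCount k (p + 1) := by
  simp only [walkCount_eq_card, Finset.card_filter]
  have hstep : ∀ s : SignType, (∑ x : Config k, if (s : ℤ) + displacement x = p then 1 else 0)
      = ∑ x : Config k, if displacement x = p - s then 1 else 0 :=
    fun s => Finset.sum_congr rfl fun x _ => if_congr (by omega) rfl rfl
  rw [sum_config_cons, Finset.sum_add_distrib, Finset.sum_add_distrib]
  simp only [displacement_cons]
  rw [hstep, hstep, hstep]
  simp only [SignType.coe_neg_one, SignType.coe_zero, SignType.coe_one, sub_neg_eq_add, sub_zero]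
  rw [add_comm, add_comm (Finset.sum _ _) (Finset.sum _ _), ← add_assoc]
  congr!

theorem walkCount_neg (k : ℕ) (p : ℤ) : walkCount k (-p) = walkCount k p := by
  induction k generalizing p with
  | zero => simp [walkCount_zero]
  | succ k ih =>
    rw [walkCount_succ, walkCount_succ, ← ih p, ← ih (p - 1), ← ih (p + 1)]
    rw [neg_sub', neg_add']
    ring_nf

/-- The reflection principle. -/
theorem ballot_eq_walkCount_sub (k : ℕ) {h : ℤ} (hh : -1 ≤ h) :
    (ballot k h : ℤ) = walkCount k h - walkCount k (h + 2) := by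
  induction k generalizing h with
  | zero =>
    rw [ballot, walkCount_zero, walkCount_zero]
    rcases eq_or_ne h 0 with rfl | h0
    · simp
    · simp [h0, show h + 2 ≠ 0 by omega]
  | succ k ih =>
    rcases eq_or_lt_of_le hh with rfl | hh'
    · rw [ballot_eq_zero_of_neg _ (by norm_num)]
      have := walkCount_neg (k + 1) 1
      norm_num [this]
    · rw [ballot, if_pos (by omega), walkCount_succ, walkCount_succ]
      push_cast
      rw [ih (by omega), ih (by omega), ih (by omega)]
      ring_nf

/-! ### The thermodynamic limit, from the growth of the Motzkin numbers -/

theorem summable_ballot_mul (a : ℕ) (p : ℤ) (F : ℤ → ℝ) :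
    Summable fun h : ℤ => (ballot a (h + p) : ℝ) * F h := by
  refine summable_of_ne_finset_zero (s := Finset.Icc (-p) (a - p)) fun h hh => ?_
  rw [Finset.mem_Icc, not_and_or, not_le, not_le] at hh
  rcases hh with hh | hh
  · rw [ballot_eq_zero_of_neg _ (by omega)]; simp
  · rw [ballot_eq_zero_of_lt (by omega)]; simp

theorem tsum_shift (F : ℤ → ℝ) (p : ℤ) : ∑' h, F (h + p) = ∑' h, F h :=
  (Equiv.addRight p).tsum_eq F

theorem ballot_succ_mul_ballot (a c : ℕ) (h : ℤ) :
    (ballot (a + 1) h : ℝ) * ballot c h =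
      (ballot a (h + -1) * ballot c h + ballot a (h + 0) * ballot c h) +
        ballot a (h + 1) * ballot c h := by
  rcases lt_or_ge h 0 with hh | hh
  · simp [ballot_eq_zero_of_neg c hh]
  · rw [ballot, if_pos hh]; push_cast; rw [add_zero, ← sub_eq_add_neg]; ring

theorem tsum_ballot_succ_mul (a c : ℕ) :
    ∑' h : ℤ, (ballot (a + 1) h : ℝ) * ballot c h =
      ∑' h : ℤ, (ballot a (h + -1) : ℝ) * ballot c h + ∑' h : ℤ, (ballot a h : ℝ) * ballot c h +
        ∑' h : ℤ, (ballot a (h + 1) : ℝ) * ballot c h := by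
  simp_rw [ballot_succ_mul_ballot]
  rw [((summable_ballot_mul _ _ _).add (summable_ballot_mul _ _ _)).tsum_add
    (summable_ballot_mul _ _ _), (summable_ballot_mul _ _ _).tsum_add (summable_ballot_mul _ _ _)]
  simp

/-- Cutting a Motzkin walk of `a + c` steps after `a` steps, according to the height there. -/
theorem tsum_ballot_mul_ballot (a c : ℕ) :
    ∑' h : ℤ, (ballot a h : ℝ) * ballot c h = ballot (a + c) 0 := by
  induction a generalizing c with
  | zero =>
    rw [tsum_eq_single 0]
    · simp [ballot]
    · intro h hh; simp [ballot, hh]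
  | succ a ih =>
    -- the transfer matrix is symmetric, so that one step may be moved to the other factor
    rw [show a + 1 + c = a + (c + 1) by ring, ← ih (c + 1)]
    simp_rw [mul_comm (ballot a _ : ℝ)]
    rw [tsum_ballot_succ_mul, tsum_ballot_succ_mul]
    have h1 := tsum_shift (fun h => (ballot a h : ℝ) * ballot c (h + -1)) 1
    have h2 := tsum_shift (fun h => (ballot a h : ℝ) * ballot c (h + 1)) (-1)
    simp only [add_neg_cancel_right, neg_add_cancel_right] at h1 h2
    rw [h1, h2]
    simp_rw [mul_comm (ballot a _ : ℝ)]
    ring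

/-- The squared `ℓ²` distance of the left-part counts from their translate by `p`. -/
noncomputable def shiftDefect (b : ℕ) (p : ℤ) : ℝ :=
  ∑' h : ℤ, ((ballot b (h + p) : ℝ) - ballot b h) ^ 2

theorem summable_shiftDefect (b : ℕ) (p q : ℤ) :
    Summable fun h : ℤ => ((ballot b (h + p) : ℝ) - ballot b (h + q)) ^ 2 := by
  have h := ((summable_ballot_mul b p fun h => (ballot b (h + p) : ℝ)).add
    (summable_ballot_mul b p fun h => (-2 * ballot b (h + q) : ℝ))).add
    (summable_ballot_mul b q fun h => (ballot b (h + q) : ℝ))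
  refine h.congr fun x => ?_
  ring

theorem shiftDefect_nonneg (b : ℕ) (p : ℤ) : 0 ≤ shiftDefect b p :=
  tsum_nonneg fun _ => sq_nonneg _

theorem tsum_ballot_shift_mul (b : ℕ) (p : ℤ) :
    ∑' h : ℤ, (ballot b (h + p) : ℝ) * ballot b h = ballot (b + b) 0 - shiftDefect b p / 2 := by
  have h1 : ∀ h : ℤ, ((ballot b (h + p) : ℝ) - ballot b h) ^ 2 =
      (ballot b (h + p) * ballot b (h + p) + ballot b (h + 0) * ballot b h) +
        ballot b (h + p) * (-2 * ballot b h) := by intro h; rw [add_zero]; ring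
  have h2 := tsum_shift (fun h => (ballot b h : ℝ) * ballot b h) p
  have h3 : ∑' h : ℤ, (ballot b (h + p) : ℝ) * (-2 * ballot b h) =
      -2 * ∑' h : ℤ, (ballot b (h + p) : ℝ) * ballot b h := by
    rw [← tsum_mul_left]; refine tsum_congr fun h => ?_; ring
  rw [shiftDefect]
  simp_rw [h1]
  rw [((summable_ballot_mul _ _ _).add (summable_ballot_mul _ _ _)).tsum_add
    (summable_ballot_mul _ _ _), (summable_ballot_mul _ _ _).tsum_add (summable_ballot_mul _ _ _),
    h2, h3]
  simp_rw [add_zero]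
  rw [tsum_ballot_mul_ballot]
  ring

theorem shiftDefect_neg (b : ℕ) (p : ℤ) : shiftDefect b (-p) = shiftDefect b p := by
  rw [shiftDefect, ← tsum_shift _ p, shiftDefect]
  refine tsum_congr fun h => ?_
  rw [add_neg_cancel_right]
  ring

theorem shiftDefect_one (b : ℕ) :
    shiftDefect b 1 = 3 * ballot (b + b) 0 - ballot (b + b + 1) 0 := by
  have h := tsum_ballot_succ_mul b b
  rw [tsum_ballot_mul_ballot, tsum_ballot_mul_ballot, tsum_ballot_shift_mul,
    tsum_ballot_shift_mul, shiftDefect_neg, show b + 1 + b = b + b + 1 by ring] at h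
  linarith

theorem shiftDefect_succ_le (b : ℕ) (p : ℤ) :
    shiftDefect b (p + 1) ≤ 2 * shiftDefect b p + 2 * shiftDefect b 1 := by
  have h1 := tsum_shift (fun h => ((ballot b (h + 1) : ℝ) - ballot b h) ^ 2) p
  have h2 : Summable fun h : ℤ => ((ballot b (h + p) : ℝ) - ballot b h) ^ 2 := by
    simpa using summable_shiftDefect b p 0
  have h3 : Summable fun h : ℤ => ((ballot b (h + (p + 1)) : ℝ) - ballot b h) ^ 2 := by
    simpa using summable_shiftDefect b (p + 1) 0
  have h4 := summable_shiftDefect b (p + 1) p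
  simp_rw [add_assoc] at h1
  rw [shiftDefect, shiftDefect, shiftDefect, ← h1, ← tsum_mul_left, ← tsum_mul_left,
    ← (h2.mul_left 2).tsum_add (h4.mul_left 2)]
  refine h3.tsum_le_tsum (fun h => ?_) ((h2.mul_left 2).add (h4.mul_left 2))
  nlinarith [sq_nonneg (((ballot b (h + p) : ℝ) - ballot b h) -
    ((ballot b (h + (p + 1)) : ℝ) - ballot b (h + p)))]

theorem ballot_sq_le_shiftDefect (b : ℕ) (h : ℤ) :
    (ballot b h : ℝ) ^ 2 ≤ shiftDefect b (h + 1) := by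
  have h2 : Summable fun x : ℤ => ((ballot b (x + (h + 1)) : ℝ) - ballot b x) ^ 2 := by
    simpa using summable_shiftDefect b (h + 1) 0
  have := h2.le_tsum (-1) fun _ _ => sq_nonneg _
  rw [ballot_eq_zero_of_neg b (h := -1) (by norm_num)] at this
  simpa [shiftDefect] using this

theorem tendsto_shiftDefect_div
    (hr : Tendsto (fun k : ℕ => (ballot (k + 1) 0 : ℝ) / ballot k 0) atTop (𝓝 3))
    (p : ℤ) :
    Tendsto (fun b : ℕ => shiftDefect b p / ballot (b + b) 0) atTop (𝓝 0) := by
  have hbb : Tendsto (fun b : ℕ => b + b) atTop atTop :=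
    tendsto_atTop_mono (fun b => Nat.le_add_left b b) tendsto_id
  have h1 : Tendsto (fun b : ℕ => shiftDefect b 1 / ballot (b + b) 0) atTop (𝓝 0) := by
    have := (hr.comp hbb).const_sub 3
    rw [sub_self] at this
    refine this.congr fun b => ?_
    have : (ballot (b + b) 0 : ℝ) ≠ 0 := by exact_mod_cast (ballot_pos _).ne'
    rw [shiftDefect_one, Function.comp_apply]
    field_simp
  have hnat : ∀ n : ℕ, Tendsto (fun b : ℕ => shiftDefect b n / ballot (b + b) 0) atTop (𝓝 0) := by
    intro n
    induction n with
    | zero => simp [shiftDefect]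
    | succ n ih =>
      have h2 := (ih.const_mul 2).add (h1.const_mul 2)
      simp only [mul_zero, add_zero] at h2
      refine squeeze_zero (fun b => div_nonneg (shiftDefect_nonneg _ _) (Nat.cast_nonneg _))
        (fun b => ?_) h2
      rw [← mul_div_assoc, ← mul_div_assoc, ← add_div]
      push_cast
      gcongr
      exact shiftDefect_succ_le b n
  obtain ⟨n, rfl | rfl⟩ := p.eq_nat_or_neg
  · exact hnat n
  · simp_rw [shiftDefect_neg]; exact hnat n

theorem tendsto_ballot_sq_div
    (hr : Tendsto (fun k : ℕ => (ballot (k + 1) 0 : ℝ) / ballot k 0) atTop (𝓝 3))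
    (h : ℤ) :
    Tendsto (fun b : ℕ => (ballot b h : ℝ) ^ 2 / ballot (b + b) 0) atTop (𝓝 0) := by
  refine squeeze_zero (fun b => by positivity) (fun b => ?_) (tendsto_shiftDefect_div hr (h + 1))
  gcongr
  exact ballot_sq_le_shiftDefect b h

theorem tendsto_ballot_mul_div
    (hr : Tendsto (fun k : ℕ => (ballot (k + 1) 0 : ℝ) / ballot k 0) atTop (𝓝 3))
    (h h' : ℤ) :
    Tendsto (fun b : ℕ => (ballot b h : ℝ) * ballot b h' / ballot (b + b) 0) atTop (𝓝 0) := by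
  have h2 := ((tendsto_ballot_sq_div hr h).add (tendsto_ballot_sq_div hr h')).div_const 2
  rw [add_zero, zero_div] at h2
  refine squeeze_zero (fun b => by positivity) (fun b => ?_) h2
  rw [← add_div, div_right_comm]
  gcongr
  nlinarith [sq_nonneg ((ballot b h : ℝ) - ballot b h')]

theorem tendsto_ballot_add_div
    (hr : Tendsto (fun k : ℕ => (ballot (k + 1) 0 : ℝ) / ballot k 0) atTop (𝓝 3))
    (L : ℕ) :
    Tendsto (fun k : ℕ => (ballot (k + L) 0 : ℝ) / ballot k 0) atTop (𝓝 (3 ^ L)) := by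
  induction L with
  | zero =>
    refine tendsto_const_nhds.congr fun k => ?_
    have : (ballot k 0 : ℝ) ≠ 0 := by exact_mod_cast (ballot_pos _).ne'
    simp [this]
  | succ L ih =>
    have h1 := (hr.comp (tendsto_add_atTop_nat L)).mul ih
    rw [← pow_succ'] at h1
    refine h1.congr fun k => ?_
    have : (ballot (k + L) 0 : ℝ) ≠ 0 := by exact_mod_cast (ballot_pos _).ne'
    rw [Function.comp_apply, div_mul_div_cancel₀ this]
    rfl

theorem abs_height_le {L : ℕ} (w : Config L) (j : ℕ) : |height w j| ≤ L := by
  refine (Finset.abs_sum_le_sum_abs _ _).trans ?_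
  refine (Finset.sum_le_sum (g := fun _ => 1) fun i _ => ?_).trans (by simp)
  split_ifs
  · cases w i <;> simp
  · simp

open Classical in
/-- The block starts at a height of at least `L`, where the constraint is void, except for
finitely many heights. -/
theorem sum_constrained_eq (b L : ℕ) (w w' : Config L) (p : ℤ) :
    (∑ h ∈ Finset.Icc (-(b : ℤ)) b, if StaysNonneg h w ∧ StaysNonneg h w' then
        (ballot b h : ℝ) * ballot b (h + p) else 0) =
      ballot (b + b) 0 - shiftDefect b p / 2 -
        ∑ h ∈ Finset.Ico (0 : ℤ) L, if StaysNonneg h w ∧ StaysNonneg h w' then 0 else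
          (ballot b h : ℝ) * ballot b (h + p) := by
  rw [← tsum_ballot_shift_mul]
  have h1 : (∑ h ∈ Finset.Icc (-(b : ℤ)) b, if StaysNonneg h w ∧ StaysNonneg h w' then
      (ballot b h : ℝ) * ballot b (h + p) else 0) = ∑' h, if StaysNonneg h w ∧ StaysNonneg h w' then
      (ballot b h : ℝ) * ballot b (h + p) else 0 := by
    refine (tsum_eq_sum fun h hh => ?_).symm
    rw [Finset.mem_Icc, not_and_or, not_le, not_le] at hh
    rcases hh with hh | hh
    · rw [ballot_eq_zero_of_neg _ (by omega)]; simp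
    · rw [ballot_eq_zero_of_lt hh]; simp
  have h2 : (∑ h ∈ Finset.Ico (0 : ℤ) L, if StaysNonneg h w ∧ StaysNonneg h w' then 0 else
      (ballot b h : ℝ) * ballot b (h + p)) = ∑' h, if StaysNonneg h w ∧ StaysNonneg h w' then 0 else
      (ballot b h : ℝ) * ballot b (h + p) := by
    refine (tsum_eq_sum fun h hh => ?_).symm
    rw [Finset.mem_Ico, not_and_or, not_le, not_lt] at hh
    rcases hh with hh | hh
    · rw [ballot_eq_zero_of_neg _ (by omega)]; simp
    · refine if_pos ⟨fun j _ => ?_, fun j _ => ?_⟩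
      · have := abs_le.mp (abs_height_le w j); omega
      · have := abs_le.mp (abs_height_le w' j); omega
  have h3 : ∀ P : ℤ → Prop, Summable fun h : ℤ => if P h then
      (ballot b (h + p) : ℝ) * ballot b h else 0 := fun P => by
    refine (summable_ballot_mul b p fun h => if P h then (ballot b h : ℝ) else 0).congr fun h => ?_
    split_ifs <;> simp
  rw [h1, h2, eq_sub_iff_add_eq, ← Summable.tsum_add]
  · refine tsum_congr fun h => ?_
    split_ifs <;> ring
  · refine (h3 fun h => StaysNonneg h w ∧ StaysNonneg h w').congr fun h => ?_
    rw [mul_comm]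
    congr!
  · refine (h3 fun h => ¬ (StaysNonneg h w ∧ StaysNonneg h w')).congr fun h => ?_
    split_ifs <;> first | rfl | rw [mul_comm]

/-- The limit of the reduced density matrix, given that consecutive Motzkin numbers have the
asymptotic ratio `3`. Then the translates of the left-part counts agree to leading order, so that
all pairs of block configurations with the same displacement get the same weight. -/
theorem tendsto_blockDensity_of_ratio
    (hr : Tendsto (fun k : ℕ => (ballot (k + 1) 0 : ℝ) / ballot k 0) atTop (𝓝 3)) (L : ℕ) :
    Tendsto (fun b : ℕ => blockDensity b L) atTop
      (𝓝 (walkDiagonal L fun p => walkCount L p / 3 ^ L)) := by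
  classical
  refine tendsto_pi_nhds.mpr fun w => tendsto_pi_nhds.mpr fun w' => ?_
  simp_rw [blockDensity_apply, walkDiagonal_apply]
  split_ifs with hp
  · have hw : (walkCount L (displacement w) : ℝ) ≠ 0 := by
      exact_mod_cast (walkCount_displacement_pos w).ne'
    rw [div_right_comm, div_self hw]
    refine (Complex.continuous_ofReal.tendsto _).comp ?_
    have hbb : Tendsto (fun b : ℕ => b + b) atTop atTop :=
      tendsto_atTop_mono (fun b => Nat.le_add_left b b) tendsto_id
    have h1 : Tendsto (fun b : ℕ => (1 - shiftDefect b (displacement w) / ballot (b + b) 0 / 2) -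
        ∑ h ∈ Finset.Ico (0 : ℤ) L, if StaysNonneg h w ∧ StaysNonneg h w' then 0 else
          (ballot b h : ℝ) * ballot b (h + displacement w) / ballot (b + b) 0) atTop
        (𝓝 ((1 - 0 / 2) - ∑ h ∈ Finset.Ico (0 : ℤ) L, 0)) := by
      refine (((tendsto_shiftDefect_div hr _).div_const 2).const_sub 1).sub
        (tendsto_finsetSum _ fun h _ => ?_)
      split_ifs
      · exact tendsto_const_nhds
      · exact tendsto_ballot_mul_div hr _ _
    have h2 := h1.div ((tendsto_ballot_add_div hr L).comp hbb) (by positivity)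
    simp only [zero_div, sub_zero, Finset.sum_const_zero] at h2
    refine h2.congr fun b => ?_
    have hb : (ballot (b + b) 0 : ℝ) ≠ 0 := by exact_mod_cast (ballot_pos _).ne'
    rw [sum_constrained_eq, Pi.div_apply, Function.comp_apply,
      show b + L + b = b + b + L by ring,
      ← div_div_div_cancel_right₀ hb ((ballot (b + b) 0 : ℝ) - _ - _)]
    congr 1
    rw [sub_div, sub_div, div_self hb, Finset.sum_div, div_right_comm]
    congr 1
    refine Finset.sum_congr rfl fun h _ => ?_
    split_ifs <;> simp
  · exact tendsto_const_nhds

/-! ### Fourier representation of the displacement distribution -/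

/-- The probability that a uniformly random path of `L` steps has displacement `p`. -/
noncomputable def walkProb (L : ℕ) (p : ℤ) : ℝ := walkCount L p / 3 ^ L

/-- The characteristic function of one uniformly random step. -/
noncomputable def stepChar (θ : ℝ) : ℝ := (1 + 2 * Real.cos θ) / 3

theorem continuous_stepChar : Continuous stepChar := by unfold stepChar; fun_prop

theorem walkProb_zero (p : ℤ) : walkProb 0 p = if p = 0 then 1 else 0 := by
  rw [walkProb, walkCount_zero]; split_ifs <;> simp

theorem walkProb_succ (L : ℕ) (p : ℤ) :
    walkProb (L + 1) p = (walkProb L (p - 1) + walkProb L p + walkProb L (p + 1)) / 3 := by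
  rw [walkProb, walkCount_succ, walkProb, walkProb, walkProb]; push_cast
  rw [pow_succ]; field_simp

theorem walkProb_neg (L : ℕ) (p : ℤ) : walkProb L (-p) = walkProb L p := by
  rw [walkProb, walkCount_neg, walkProb]

theorem walkProb_nonneg (L : ℕ) (p : ℤ) : 0 ≤ walkProb L p := by unfold walkProb; positivity

theorem walkProb_eq_integral (L : ℕ) (p : ℤ) :
    walkProb L p = 1 / (2 * Real.pi) *
      ∫ θ in -Real.pi..Real.pi, stepChar θ ^ L * Real.cos (p * θ) := by
  have hπ := Real.pi_ne_zero
  induction L generalizing p with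
  | zero =>
    rw [walkProb_zero]
    simp only [pow_zero, one_mul]
    split_ifs with h
    · simp [h]; field_simp; ring
    · have hp : (p : ℝ) ≠ 0 := by exact_mod_cast h
      rw [intervalIntegral.integral_comp_mul_left _ hp, integral_cos]
      simp [Real.sin_int_mul_pi]
  | succ L ih =>
    have hint : ∀ q : ℤ, IntervalIntegrable (fun θ => stepChar θ ^ L * Real.cos (q * θ))
        MeasureTheory.volume (-Real.pi) Real.pi := fun q =>
      Continuous.intervalIntegrable ((continuous_stepChar.pow L).mul (by fun_prop)) _ _
    rw [walkProb_succ, ih, ih, ih, ← mul_add, ← mul_add,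
      ← intervalIntegral.integral_add (hint _) (hint _),
      ← intervalIntegral.integral_add ((hint _).add (hint _)) (hint _), mul_div_assoc,
      ← intervalIntegral.integral_div]
    congr 1
    refine intervalIntegral.integral_congr fun θ _ => ?_
    simp only [pow_succ, Int.cast_sub, Int.cast_add, Int.cast_one, sub_mul, add_mul, one_mul,
      Real.cos_sub, Real.cos_add]
    conv_rhs => rw [stepChar]
    simp only [stepChar]
    ring

/-- The integrand of the Fourier representation after the substitution `θ = t / √L`, extended by
zero to the whole line. -/
noncomputable def scaledChar (L : ℕ) (t : ℝ) : ℝ :=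
  (Set.Ioc (-(Real.pi * √L)) (Real.pi * √L)).indicator (fun t => stepChar (t / √L) ^ L) t

theorem sqrt_mul_integral_stepChar {L : ℕ} (hL : 0 < L) (G : ℝ → ℝ) :
    √L * ∫ θ in -Real.pi..Real.pi, stepChar θ ^ L * G θ = ∫ t, scaledChar L t * G (t / √L) := by
  have hs : (0 : ℝ) < √L := Real.sqrt_pos.mpr (by exact_mod_cast hL)
  have h := intervalIntegral.integral_comp_div (a := -(Real.pi * √L)) (b := Real.pi * √L)
    (fun θ => stepChar θ ^ L * G θ) hs.ne'
  rw [neg_div, mul_div_cancel_right₀ _ hs.ne', smul_eq_mul] at h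
  rw [← h, intervalIntegral.integral_of_le (by have := Real.pi_pos; nlinarith [mul_pos this hs]),
    ← MeasureTheory.integral_indicator measurableSet_Ioc]
  congr 1
  ext t
  rw [scaledChar, Set.indicator_mul_left]

theorem measurable_scaledChar (L : ℕ) : Measurable (scaledChar L) :=
  ((continuous_stepChar.comp (continuous_id.div_const _)).pow L).measurable.indicator
    measurableSet_Ioc

theorem tendsto_mul_one_sub_cos (t : ℝ) :
    Tendsto (fun L : ℕ => (L : ℝ) * (1 - Real.cos (t / √L))) atTop (𝓝 (t ^ 2 / 2)) := by
  have h1 : Tendsto (fun L : ℕ => t ^ 4 / (L : ℝ)) atTop (𝓝 0) :=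
    tendsto_const_div_atTop_nhds_zero_nat _
  rw [tendsto_iff_dist_tendsto_zero]
  refine squeeze_zero' (Eventually.of_forall fun _ => dist_nonneg) ?_ h1
  have h2 : ∀ᶠ L : ℕ in atTop, t ^ 2 + 1 ≤ L :=
    tendsto_natCast_atTop_atTop.eventually_ge_atTop _
  filter_upwards [h2] with L hL
  have hL0 : (0 : ℝ) < L := by nlinarith [sq_nonneg t]
  have hsq : (t / √L) ^ 2 = t ^ 2 / L := by rw [div_pow, Real.sq_sqrt hL0.le]
  have hle : |t / √L| ≤ 1 := by
    rw [← sq_le_one_iff_abs_le_one, hsq, div_le_one hL0]; linarith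
  have h3 := Real.cos_bound hle
  rw [show |t / √L| ^ 4 = (t / √L) ^ 4 by rw [← abs_pow]; exact abs_of_nonneg (by positivity),
    show (t / √L) ^ 4 = ((t / √L) ^ 2) ^ 2 by ring, hsq] at h3
  rw [Real.dist_eq]
  have h4 : (L : ℝ) * (1 - Real.cos (t / √L)) - t ^ 2 / 2
      = -(L * (Real.cos (t / √L) - (1 - t ^ 2 / L / 2))) := by field_simp; ring
  rw [h4, abs_neg, abs_mul, abs_of_pos hL0]
  calc (L : ℝ) * |Real.cos (t / √L) - (1 - t ^ 2 / L / 2)|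
      ≤ L * ((t ^ 2 / L) ^ 2 * (5 / 96)) := by gcongr
    _ = t ^ 4 / L * (5 / 96) := by field_simp
    _ ≤ t ^ 4 / L := by
        have : 0 ≤ t ^ 4 / L := by positivity
        linarith

theorem tendsto_scaledChar (t : ℝ) :
    Tendsto (fun L : ℕ => scaledChar L t) atTop (𝓝 (Real.exp (-t ^ 2 / 3))) := by
  have h1 : Tendsto (fun L : ℕ => (L : ℝ) * (stepChar (t / √L) - 1)) atTop (𝓝 (-t ^ 2 / 3)) := by
    have := (tendsto_mul_one_sub_cos t).const_mul (-(2 / 3))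
    rw [show -(2 / 3) * (t ^ 2 / 2) = -t ^ 2 / 3 by ring] at this
    refine this.congr fun L => ?_
    rw [stepChar]; ring
  refine (Real.tendsto_one_add_pow_exp_of_tendsto h1).congr' ?_
  have h2 : ∀ᶠ L : ℕ in atTop, t ^ 2 + 1 ≤ L :=
    tendsto_natCast_atTop_atTop.eventually_ge_atTop _
  filter_upwards [h2] with L hL
  have h3 : |t| < √L := (Real.lt_sqrt (abs_nonneg t)).mpr (by rw [sq_abs]; linarith)
  have h4 : √L ≤ Real.pi * √L := by nlinarith [Real.pi_gt_three, Real.sqrt_nonneg (L : ℝ)]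
  rw [scaledChar, Set.indicator_of_mem]
  · ring
  · obtain ⟨h5, h6⟩ := abs_lt.mp h3
    exact ⟨by linarith, by linarith⟩

theorem abs_stepChar_le {θ : ℝ} (h : |θ| ≤ Real.pi) : |stepChar θ| ≤ Real.exp (-θ ^ 2 / 10) := by
  have hπ := Real.pi_pos
  have hπ2 : Real.pi ^ 2 < 10 := by nlinarith [Real.pi_lt_d2]
  have hsq : θ ^ 2 ≤ Real.pi ^ 2 := sq_le_sq' (by linarith [(abs_le.mp h).1]) (abs_le.mp h).2
  rw [abs_le]
  constructor
  · have h1 : -(1 / 3) ≤ stepChar θ := by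
      rw [stepChar]; linarith [Real.neg_one_le_cos θ]
    have h2 : Real.exp (-1) ≤ Real.exp (-θ ^ 2 / 10) := Real.exp_le_exp.mpr (by linarith)
    have h3 : (1 : ℝ) / 3 ≤ Real.exp (-1) := by
      rw [Real.exp_neg, one_div]
      exact inv_anti₀ (Real.exp_pos 1) (by linarith [Real.exp_one_lt_d9])
    linarith
  · have h1 := Real.cos_le_one_sub_mul_cos_sq h
    have h2 := Real.add_one_le_exp (-θ ^ 2 / 10)
    have h3 : (1 : ℝ) / 10 ≤ 1 / Real.pi ^ 2 := one_div_le_one_div_of_le (by positivity) hπ2.le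
    have h4 : θ ^ 2 * (1 / 10) ≤ θ ^ 2 * (1 / Real.pi ^ 2) := by gcongr
    rw [stepChar]
    have h5 : 2 / Real.pi ^ 2 * θ ^ 2 = 2 * (θ ^ 2 * (1 / Real.pi ^ 2)) := by ring
    nlinarith [sq_nonneg θ]

theorem abs_scaledChar_le (L : ℕ) (t : ℝ) : |scaledChar L t| ≤ Real.exp (-t ^ 2 / 10) := by
  rw [scaledChar]
  by_cases ht : t ∈ Set.Ioc (-(Real.pi * √L)) (Real.pi * √L)
  · rw [Set.indicator_of_mem ht]
    have hs : 0 < √(L : ℝ) := by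
      by_contra! h0
      have : √(L : ℝ) = 0 := le_antisymm h0 (Real.sqrt_nonneg _)
      rw [this, mul_zero, neg_zero] at ht
      exact absurd ht.1 (not_lt.mpr ht.2)
    have hle : |t / √L| ≤ Real.pi := by
      rw [abs_div, abs_of_pos hs, div_le_iff₀ hs, abs_le]
      exact ⟨ht.1.le, ht.2⟩
    rw [abs_pow]
    refine (pow_le_pow_left₀ (abs_nonneg _) (abs_stepChar_le hle) L).trans_eq ?_
    rw [← Real.exp_nat_mul, div_pow, Real.sq_sqrt (Nat.cast_nonneg _)]
    have hL : (L : ℝ) ≠ 0 := (Real.sqrt_pos.mp hs).ne'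
    congr 1
    field_simp
  · rw [Set.indicator_of_notMem ht, abs_zero]; positivity

theorem integrable_exp_neg_sq_div {c : ℝ} (hc : 0 < c) :
    MeasureTheory.Integrable fun t : ℝ => Real.exp (-t ^ 2 / c) := by
  refine (integrable_exp_neg_mul_sq (b := 1 / c) (by positivity)).congr
    (Eventually.of_forall fun t => ?_)
  simp only; congr 1; ring

theorem integrable_scaledChar (L : ℕ) : MeasureTheory.Integrable (scaledChar L) :=
  (integrable_exp_neg_sq_div (c := 10) (by norm_num)).mono'
    (measurable_scaledChar L).aestronglyMeasurable
    (Eventually.of_forall fun t => by rw [Real.norm_eq_abs]; exact abs_scaledChar_le L t)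

/-! ### The local limit theorem -/

/-- The centred Gaussian density of variance `2/3`, the variance of one step. -/
noncomputable def gaussDensity (x : ℝ) : ℝ := √(3 / (4 * Real.pi)) * Real.exp (-(3 / 4) * x ^ 2)

theorem continuous_gaussDensity : Continuous gaussDensity := by unfold gaussDensity; fun_prop

theorem integral_exp_mul_cos (x : ℝ) :
    ∫ t : ℝ, Real.exp (-t ^ 2 / 3) * Real.cos (x * t) = 2 * Real.pi * gaussDensity x := by
  have hπ := Real.pi_pos
  have h := fourierIntegral_gaussian (b := ((1 / 3 : ℝ) : ℂ)) (by simp) x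
  have h1 : ∀ t : ℝ, Complex.exp (Complex.I * x * t) * Complex.exp (-((1 / 3 : ℝ) : ℂ) * t ^ 2) =
      ((Real.exp (-t ^ 2 / 3) : ℝ) : ℂ) * Complex.exp (((x * t : ℝ) : ℂ) * Complex.I) := by
    intro t
    rw [mul_comm, Complex.ofReal_exp]
    congr 2
    · push_cast; ring
    · push_cast; ring
  have hint : MeasureTheory.Integrable fun t : ℝ =>
      ((Real.exp (-t ^ 2 / 3) : ℝ) : ℂ) * Complex.exp (((x * t : ℝ) : ℂ) * Complex.I) := by
    refine (integrable_exp_neg_sq_div (c := 3) (by norm_num)).ofReal.mul_bdd (c := 1) ?_ ?_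
    · exact Continuous.aestronglyMeasurable (by fun_prop)
    · exact Eventually.of_forall fun t => (Complex.norm_exp_ofReal_mul_I _).le
  simp_rw [h1] at h
  have h2 := congrArg Complex.re h
  rw [← RCLike.re_eq_complex_re, ← integral_re hint] at h2
  have h3 : ∀ t : ℝ, RCLike.re (((Real.exp (-t ^ 2 / 3) : ℝ) : ℂ) *
      Complex.exp (((x * t : ℝ) : ℂ) * Complex.I)) = Real.exp (-t ^ 2 / 3) * Real.cos (x * t) := by
    intro t
    rw [RCLike.re_eq_complex_re, Complex.re_ofReal_mul, Complex.exp_ofReal_mul_I_re]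
  simp_rw [h3] at h2
  rw [h2, RCLike.re_eq_complex_re]
  have h4 : ((Real.pi : ℂ) / ((1 / 3 : ℝ) : ℂ)) ^ (1 / 2 : ℂ) = ((√(3 * Real.pi) : ℝ) : ℂ) := by
    rw [Real.sqrt_eq_rpow, Complex.ofReal_cpow (by positivity)]
    congr 1
    · push_cast; ring
    · push_cast; rfl
  have h5 : Complex.exp (-(x : ℂ) ^ 2 / (4 * ((1 / 3 : ℝ) : ℂ))) =
      ((Real.exp (-(3 / 4) * x ^ 2) : ℝ) : ℂ) := by
    rw [Complex.ofReal_exp]; congr 1; push_cast; ring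
  rw [h4, h5, ← Complex.ofReal_mul, Complex.ofReal_re, gaussDensity, ← mul_assoc]
  congr 1
  rw [Real.sqrt_eq_iff_mul_self_eq (by positivity) (by positivity), mul_mul_mul_comm,
    Real.mul_self_sqrt (by positivity)]
  field_simp; ring

theorem sqrt_mul_walkProb {L : ℕ} (hL : 0 < L) (p : ℤ) :
    √L * walkProb L p = 1 / (2 * Real.pi) * ∫ t, scaledChar L t * Real.cos (p / √L * t) := by
  rw [walkProb_eq_integral, mul_left_comm,
    sqrt_mul_integral_stepChar hL fun θ => Real.cos (p * θ)]
  congr 2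
  ext t
  congr 2
  ring

/-- The `L¹` distance of the rescaled characteristic function from its Gaussian limit, which bounds
the error in the local limit theorem. -/
noncomputable def charError (L : ℕ) : ℝ := ∫ t : ℝ, |scaledChar L t - Real.exp (-t ^ 2 / 3)|

theorem tendsto_charError : Tendsto charError atTop (𝓝 0) := by
  have h := MeasureTheory.tendsto_integral_of_dominated_convergence
    (F := fun (L : ℕ) t => |scaledChar L t - Real.exp (-t ^ 2 / 3)|) (f := fun _ => (0 : ℝ))
    (fun t => Real.exp (-t ^ 2 / 10) + Real.exp (-t ^ 2 / 3)) (μ := MeasureTheory.volume)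
    (fun L => ((measurable_scaledChar L).sub (by fun_prop)).abs.aestronglyMeasurable)
    ((integrable_exp_neg_sq_div (by norm_num)).add (integrable_exp_neg_sq_div (by norm_num)))
    (fun L => Eventually.of_forall fun t => by
      rw [Real.norm_eq_abs, abs_abs]
      refine (abs_sub _ _).trans ?_
      rw [abs_of_pos (Real.exp_pos (-t ^ 2 / 3))]
      gcongr
      exact abs_scaledChar_le L t)
    (Eventually.of_forall fun t => by
      have := ((tendsto_scaledChar t).sub_const (Real.exp (-t ^ 2 / 3))).abs
      simpa using this)
  rwa [MeasureTheory.integral_zero] at h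

/-- The local limit theorem, uniformly in `p`. -/
theorem abs_sqrt_mul_walkProb_sub_le {L : ℕ} (hL : 0 < L) (p : ℤ) :
    |√L * walkProb L p - gaussDensity (p / √L)| ≤ charError L := by
  have hπ := Real.pi_gt_three
  have hcos : ∀ F : ℝ → ℝ, MeasureTheory.Integrable F → MeasureTheory.Integrable
      fun t => F t * Real.cos (p / √L * t) := fun F hF =>
    hF.mul_bdd (c := 1) (Continuous.aestronglyMeasurable (by fun_prop))
      (Eventually.of_forall fun t => Real.abs_cos_le_one _)
  have h1 : gaussDensity (p / √L) =
      1 / (2 * Real.pi) * ∫ t : ℝ, Real.exp (-t ^ 2 / 3) * Real.cos (p / √L * t) := by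
    rw [integral_exp_mul_cos]; field_simp
  rw [sqrt_mul_walkProb hL, h1, ← mul_sub, ← MeasureTheory.integral_sub
    (hcos _ (integrable_scaledChar L)) (hcos _ (integrable_exp_neg_sq_div (by norm_num))), abs_mul]
  have h2 : |∫ t : ℝ, (scaledChar L t * Real.cos (p / √L * t) -
      Real.exp (-t ^ 2 / 3) * Real.cos (p / √L * t))| ≤ charError L := by
    refine (MeasureTheory.abs_integral_le_integral_abs).trans ?_
    have hi : MeasureTheory.Integrable fun t => scaledChar L t - Real.exp (-t ^ 2 / 3) :=
      (integrable_scaledChar L).sub (integrable_exp_neg_sq_div (by norm_num))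
    refine MeasureTheory.integral_mono_of_nonneg (Eventually.of_forall fun t => abs_nonneg _)
      hi.abs (Eventually.of_forall fun t => ?_)
    simp only
    rw [← sub_mul, abs_mul]
    exact mul_le_of_le_one_right (abs_nonneg _) (Real.abs_cos_le_one _)
  have h3 : |1 / (2 * Real.pi)| ≤ 1 := by
    rw [abs_of_pos (by positivity), div_le_one (by positivity)]; linarith
  calc _ ≤ 1 * charError L := mul_le_mul h3 h2 (abs_nonneg _) zero_le_one
    _ = _ := one_mul _

/-! ### The growth of the Motzkin numbers -/

theorem ballot_zero_div_pow (k : ℕ) :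
    (ballot k 0 : ℝ) / 3 ^ k = walkProb k 0 - walkProb k 2 := by
  have h := ballot_eq_walkCount_sub k (h := 0) (by norm_num)
  have h' : (ballot k 0 : ℝ) = walkCount k 0 - walkCount k 2 := by exact_mod_cast h
  rw [h', walkProb, walkProb]; ring

/-- The Motzkin numbers grow like `3 ^ k * k ^ (-3 / 2)`. -/
theorem tendsto_ballot_growth : ∃ C : ℝ, 0 < C ∧
    Tendsto (fun k : ℕ => √k * (k * (ballot k 0 / 3 ^ k))) atTop (𝓝 C) := by
  have hπ := Real.pi_pos
  have hint : MeasureTheory.Integrable fun t : ℝ => Real.exp (-t ^ 2 / 3) * (2 * t ^ 2) := by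
    have := (integrable_rpow_mul_exp_neg_mul_sq (b := 1 / 3) (by norm_num) (s := 2)
      (by norm_num)).const_mul 2
    refine this.congr (Eventually.of_forall fun t => ?_)
    simp only [Real.rpow_two]
    rw [show -(1 / 3) * t ^ 2 = -t ^ 2 / 3 by ring]; ring
  have hint' : MeasureTheory.Integrable fun t : ℝ => Real.exp (-t ^ 2 / 10) * (2 * t ^ 2) := by
    have := (integrable_rpow_mul_exp_neg_mul_sq (b := 1 / 10) (by norm_num) (s := 2)
      (by norm_num)).const_mul 2
    refine this.congr (Eventually.of_forall fun t => ?_)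
    simp only [Real.rpow_two]
    rw [show -(1 / 10) * t ^ 2 = -t ^ 2 / 10 by ring]; ring
  refine ⟨1 / (2 * Real.pi) * ∫ t : ℝ, Real.exp (-t ^ 2 / 3) * (2 * t ^ 2), ?_, ?_⟩
  · refine mul_pos (by positivity) ?_
    rw [MeasureTheory.integral_pos_iff_support_of_nonneg (fun t => by positivity) hint]
    refine lt_of_lt_of_le ?_ (MeasureTheory.measure_mono (s := Set.Ioo (0 : ℝ) 1) fun t ht => ?_)
    · simp
    · have := ht.1
      rw [Function.mem_support]; positivity
  · have hlim := MeasureTheory.tendsto_integral_of_dominated_convergence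
      (F := fun (k : ℕ) t => scaledChar k t * (k * (1 - Real.cos (2 * t / √k))))
      (f := fun t => Real.exp (-t ^ 2 / 3) * (2 * t ^ 2))
      (fun t => Real.exp (-t ^ 2 / 10) * (2 * t ^ 2)) (μ := MeasureTheory.volume)
      (fun k => ((measurable_scaledChar k).mul (by fun_prop)).aestronglyMeasurable) hint'
      (fun k => Eventually.of_forall fun t => by
        rw [Real.norm_eq_abs, abs_mul]
        refine mul_le_mul (abs_scaledChar_le k t) ?_ (abs_nonneg _) (Real.exp_pos _).le
        have h0 := Real.cos_le_one (2 * t / √k)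
        rw [abs_of_nonneg (mul_nonneg (Nat.cast_nonneg _) (by linarith))]
        have h1 := Real.one_sub_sq_div_two_le_cos (x := 2 * t / √k)
        rw [div_pow, Real.sq_sqrt (Nat.cast_nonneg _)] at h1
        rcases Nat.eq_zero_or_pos k with rfl | hk
        · simp; positivity
        · have hk' : (0 : ℝ) < k := by exact_mod_cast hk
          calc (k : ℝ) * (1 - Real.cos (2 * t / √k)) ≤ k * ((2 * t) ^ 2 / k / 2) := by
                gcongr; linarith
            _ = 2 * t ^ 2 := by field_simp)
      (Eventually.of_forall fun t => by
        have := (tendsto_scaledChar t).mul (tendsto_mul_one_sub_cos (2 * t))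
        rwa [show (2 * t) ^ 2 / 2 = 2 * t ^ 2 by ring] at this)
    refine (hlim.const_mul (1 / (2 * Real.pi))).congr' ?_
    filter_upwards [eventually_gt_atTop 0] with k hk
    have h1 := sqrt_mul_integral_stepChar hk fun θ => (k : ℝ) * (1 - Real.cos (2 * θ))
    simp_rw [← mul_div_assoc] at h1
    rw [← h1, ballot_zero_div_pow, walkProb_eq_integral, walkProb_eq_integral, ← mul_sub,
      ← intervalIntegral.integral_sub]
    · have h2 : ∫ θ in -Real.pi..Real.pi, stepChar θ ^ k * (k * (1 - Real.cos (2 * θ))) =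
          k * ∫ θ in -Real.pi..Real.pi, (stepChar θ ^ k * Real.cos ((0 : ℤ) * θ) -
            stepChar θ ^ k * Real.cos ((2 : ℤ) * θ)) := by
        rw [← intervalIntegral.integral_const_mul]
        refine intervalIntegral.integral_congr fun θ _ => ?_
        simp; ring
      rw [h2]; ring
    · exact Continuous.intervalIntegrable ((continuous_stepChar.pow k).mul (by fun_prop)) _ _
    · exact Continuous.intervalIntegrable ((continuous_stepChar.pow k).mul (by fun_prop)) _ _

theorem tendsto_ballot_ratio :
    Tendsto (fun k : ℕ => (ballot (k + 1) 0 : ℝ) / ballot k 0) atTop (𝓝 3) := by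
  obtain ⟨C, hC, h⟩ := tendsto_ballot_growth
  have h1 := (h.comp (tendsto_add_atTop_nat 1)).div h hC.ne'
  rw [div_self hC.ne'] at h1
  have h2 : Tendsto (fun k : ℕ => (k : ℝ) / ((k + 1 : ℕ) : ℝ)) atTop (𝓝 1) := by
    simpa using tendsto_natCast_div_add_atTop (1 : ℝ)
  have h3 := ((h1.mul h2).mul ((Real.continuous_sqrt.tendsto 1).comp h2)).mul_const 3
  simp only [one_mul, Real.sqrt_one] at h3
  refine h3.congr' ?_
  filter_upwards [eventually_gt_atTop 0] with k hk
  have hk' : (0 : ℝ) < k := by exact_mod_cast hk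
  have hb : (0 : ℝ) < ballot k 0 := by exact_mod_cast ballot_pos k
  have hk1 : (0 : ℝ) < ((k + 1 : ℕ) : ℝ) := by positivity
  have hs : (0 : ℝ) < √k := Real.sqrt_pos.mpr hk'
  have hs1 : (0 : ℝ) < √((k + 1 : ℕ) : ℝ) := Real.sqrt_pos.mpr hk1
  simp only [Pi.div_apply, Function.comp_apply]
  rw [Real.sqrt_div hk'.le, pow_succ]
  field_simp

/-- In the limit of a long chain, all pairs of block configurations with the same displacement have
the same weight `3 ^ (-L)`. -/
theorem tendsto_blockDensity (L : ℕ) :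
    Tendsto (fun b : ℕ => blockDensity b L) atTop (𝓝 (walkDiagonal L (walkProb L))) :=
  tendsto_blockDensity_of_ratio tendsto_ballot_ratio L

/-! ### Tails of the displacement distribution -/

/-- The distribution of the displacement as an image of the uniform distribution on paths. -/
theorem sum_walkProb_mul (L : ℕ) (F : ℤ → ℝ) :
    ∑ p ∈ Finset.Icc (-(L : ℤ)) L, walkProb L p * F p =
      (∑ w : Config L, F (displacement w)) / 3 ^ L := by
  rw [← Finset.sum_fiberwise_of_maps_to (t := Finset.Icc (-(L : ℤ)) L) (g := displacement)
    fun w _ => displacement_mem_Icc w, Finset.sum_div]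
  refine Finset.sum_congr rfl fun p _ => ?_
  rw [Finset.sum_congr rfl (g := fun _ => F p) fun w hw => by rw [(Finset.mem_filter.mp hw).2],
    Finset.sum_const, ← walkCount_eq_card, walkProb, nsmul_eq_mul]
  ring

theorem sum_walkProb (L : ℕ) : ∑ p ∈ Finset.Icc (-(L : ℤ)) L, walkProb L p = 1 := by
  have h := sum_walkProb_mul L fun _ => 1
  have h3 : Fintype.card SignType = 3 := by decide
  simp only [mul_one, Finset.sum_const, Finset.card_univ, Fintype.card_pi, Finset.prod_const,
    Fintype.card_fin, h3, nsmul_eq_mul] at h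
  rw [h]; push_cast; exact div_self (by positivity)

theorem sum_exp_displacement (L : ℕ) (t : ℝ) :
    ∑ w : Config L, Real.exp (t * displacement w) = (1 + 2 * Real.cosh t) ^ L := by
  induction L with
  | zero => rw [Fintype.sum_unique]; simp [displacement]
  | succ L ih =>
    rw [sum_config_cons, pow_succ, ← ih, Finset.sum_mul]
    refine Finset.sum_congr rfl fun w _ => ?_
    simp only [displacement_cons, SignType.coe_neg_one, SignType.coe_zero, SignType.coe_one]
    push_cast
    rw [mul_add, mul_add, mul_add, Real.exp_add, Real.exp_add, Real.exp_add, Real.cosh_eq]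
    simp
    ring

theorem walkProb_eq_zero {L : ℕ} {p : ℤ} (hp : p ∉ Finset.Icc (-(L : ℤ)) L) :
    walkProb L p = 0 := by
  rw [walkProb, walkCount_eq_card, Finset.card_eq_zero.mpr, Nat.cast_zero, zero_div]
  refine Finset.filter_eq_empty_iff.mpr fun w _ h => hp ?_
  rw [← h]; exact displacement_mem_Icc w

theorem sum_walkProb_mul_exp_le (L : ℕ) (t : ℝ) (S : Finset ℤ) :
    ∑ p ∈ S, walkProb L p * Real.exp (t * p) ≤ Real.exp (L * t ^ 2 / 2) := by
  have h1 : ∑ p ∈ S, walkProb L p * Real.exp (t * p) ≤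
      ∑ p ∈ Finset.Icc (-(L : ℤ)) L, walkProb L p * Real.exp (t * p) := by
    rw [← Finset.sum_subset (Finset.inter_subset_left (s₁ := S) (s₂ := Finset.Icc (-(L : ℤ)) L))]
    · exact Finset.sum_le_sum_of_subset_of_nonneg Finset.inter_subset_right fun p _ _ =>
        mul_nonneg (walkProb_nonneg _ _) (Real.exp_pos _).le
    · intro p hpS hp
      rw [walkProb_eq_zero fun h => hp (Finset.mem_inter.mpr ⟨hpS, h⟩), zero_mul]
  refine h1.trans ?_
  rw [sum_walkProb_mul L fun p => Real.exp (t * p), sum_exp_displacement, ← div_pow, mul_div_assoc,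
    Real.exp_nat_mul]
  have h2 := Real.cosh_le_exp_half_sq t
  have h3 := Real.one_le_cosh t
  gcongr
  linarith

/-- The displacement distribution is unimodal. -/
theorem walkProb_succ_le (L : ℕ) {p : ℤ} (hp : 0 ≤ p) : walkProb L (p + 1) ≤ walkProb L p := by
  induction L generalizing p with
  | zero =>
    rw [walkProb_zero, if_neg (by omega)]; exact walkProb_nonneg _ _
  | succ L ih =>
    rw [walkProb_succ, walkProb_succ]
    have key : walkProb L (p + 1 + 1) ≤ walkProb L (p - 1) := by
      rcases eq_or_lt_of_le hp with rfl | hp'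
      · have h1 := ih (p := 1) (by norm_num)
        have h2 := walkProb_neg L 1
        simp only [zero_add, zero_sub, h2]; exact h1
      · have h1 := ih (p := p - 1) (by omega)
        rw [sub_add_cancel] at h1
        exact ((ih (by omega)).trans (ih hp)).trans h1
    rw [add_sub_cancel_right]
    linarith

theorem walkProb_le_of_le (L : ℕ) {p q : ℤ} (hq : 0 ≤ q) (h : q ≤ p) :
    walkProb L p ≤ walkProb L q := by
  induction p, h using Int.leInduction with
  | base => exact le_rfl
  | succ p hp ih => exact (walkProb_succ_le L (hq.trans hp)).trans ih

/-- By unimodality at least `p / 2` displacements between `p / 2` and `p` are at least as likely as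
`p`, and the exponential moments bound their total probability. -/
theorem mul_walkProb_le (L : ℕ) (p : ℤ) {t : ℝ} (ht : 0 ≤ t) :
    p * walkProb L p ≤ 2 * Real.exp (L * t ^ 2 / 2) * Real.exp (-(t * p / 2)) := by
  have h1 := sum_walkProb_mul_exp_le L t (Finset.Icc ((p + 1) / 2) p)
  have h2 : (p : ℝ) / 2 * (walkProb L p * Real.exp (t * p / 2)) ≤
      ∑ q ∈ Finset.Icc ((p + 1) / 2) p, walkProb L q * Real.exp (t * q) := by
    calc (p : ℝ) / 2 * (walkProb L p * Real.exp (t * p / 2))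
        ≤ ((Finset.Icc ((p + 1) / 2) p).card : ℝ) * (walkProb L p * Real.exp (t * p / 2)) := by
          refine mul_le_mul_of_nonneg_right ?_ (mul_nonneg (walkProb_nonneg _ _) (Real.exp_pos _).le)
          rw [Int.card_Icc]
          have : p ≤ 2 * ((p + 1 - (p + 1) / 2).toNat : ℤ) := by omega
          have : (p : ℝ) ≤ 2 * ((p + 1 - (p + 1) / 2).toNat : ℝ) := by exact_mod_cast this
          linarith
      _ = ∑ q ∈ Finset.Icc ((p + 1) / 2) p, walkProb L p * Real.exp (t * p / 2) := by
          rw [Finset.sum_const, nsmul_eq_mul]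
      _ ≤ _ := by
          refine Finset.sum_le_sum fun q hq => ?_
          rw [Finset.mem_Icc] at hq
          have h3 : p ≤ 2 * q := by omega
          have h4 : (p : ℝ) ≤ 2 * q := by exact_mod_cast h3
          refine mul_le_mul (walkProb_le_of_le L (by omega) hq.2) ?_ (Real.exp_pos _).le
            (walkProb_nonneg _ _)
          exact Real.exp_le_exp.mpr (by nlinarith)
  have h5 := h2.trans h1
  rw [Real.exp_neg, ← div_eq_mul_inv, le_div_iff₀ (Real.exp_pos _)]
  linarith

/-- An exponential bound of the right order for the whole distribution: near the centre from the
local limit theorem, elsewhere from `mul_walkProb_le`. -/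
theorem exists_walkProb_le : ∃ C : ℝ, 1 ≤ C ∧ ∀ L : ℕ, 0 < L → ∀ p : ℤ,
    √L * walkProb L p ≤ C * Real.exp (-(1 / 2) * (|(p : ℝ)| / √L)) := by
  obtain ⟨K, hK⟩ := tendsto_charError.bddAbove_range
  have hK' : ∀ L, charError L ≤ K := fun L => hK ⟨L, rfl⟩
  have hK0 : 0 ≤ K := (MeasureTheory.integral_nonneg fun _ => abs_nonneg _).trans (hK' 0)
  have hφ : ∀ x, gaussDensity x ≤ 1 := fun x => by
    rw [gaussDensity]
    refine mul_le_one₀ ?_ (Real.exp_pos _).le (Real.exp_le_one_iff.mpr (by nlinarith [sq_nonneg x]))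
    rw [Real.sqrt_le_one, div_le_one (by positivity)]
    linarith [Real.pi_gt_three]
  have he : (1 : ℝ) ≤ Real.exp (1 / 2) := Real.one_le_exp (by norm_num)
  refine ⟨(K + 2) * Real.exp (1 / 2), by nlinarith, fun L hL p => ?_⟩
  have hs : (0 : ℝ) < √L := Real.sqrt_pos.mpr (by exact_mod_cast hL)
  wlog hp : 0 ≤ p generalizing p
  · have := this (-p) (by omega)
    rwa [walkProb_neg, Int.cast_neg, abs_neg] at this
  have hp' : (0 : ℝ) ≤ p := by exact_mod_cast hp
  rw [abs_of_nonneg hp']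
  rcases le_total (p : ℝ) √L with h | h
  · have h1 := (abs_le.mp (abs_sqrt_mul_walkProb_sub_le hL p)).2
    have h2 : p / √L ≤ 1 := (div_le_one hs).mpr h
    have h3 : 1 ≤ Real.exp (1 / 2) * Real.exp (-(1 / 2) * (p / √L)) := by
      rw [← Real.exp_add]; exact Real.one_le_exp (by linarith)
    calc √L * walkProb L p ≤ (K + 2) * 1 := by linarith [hK' L, hφ (p / √L)]
      _ ≤ (K + 2) * (Real.exp (1 / 2) * Real.exp (-(1 / 2) * (p / √L))) := by gcongr
      _ = _ := by ring
  · have h1 := mul_walkProb_le L p (t := 1 / √L) (by positivity)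
    rw [show (L : ℝ) * (1 / √L) ^ 2 / 2 = 1 / 2 by
      rw [div_pow, Real.sq_sqrt (Nat.cast_nonneg _)]; field_simp,
      show -(1 / √L * p / 2) = -(1 / 2) * (p / √L) by ring] at h1
    calc √L * walkProb L p ≤ p * walkProb L p := by
          gcongr; exact walkProb_nonneg _ _
      _ ≤ _ := h1
      _ ≤ _ := by gcongr; linarith

/-! ### Riemann sums on the scale `√L` -/

theorem integrable_exp_neg_mul_abs {c : ℝ} (hc : 0 < c) :
    MeasureTheory.Integrable fun x : ℝ => Real.exp (-c * |x|) := by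
  rw [← MeasureTheory.integrableOn_univ, ← Set.Iic_union_Ioi (a := (0 : ℝ))]
  refine MeasureTheory.IntegrableOn.union ?_ ?_
  · refine (integrableOn_exp_mul_Iic hc 0).congr_fun (fun x hx => ?_) measurableSet_Iic
    simp only
    rw [abs_of_nonpos hx]; congr 1; ring
  · refine (integrableOn_exp_mul_Ioi (neg_lt_zero.mpr hc) 0).congr_fun (fun x hx => ?_)
      measurableSet_Ioi
    simp only
    rw [abs_of_pos hx]

theorem integral_floor_mul {s : ℝ} (hs : 0 < s) (S : Finset ℤ) (F : ℤ → ℝ) :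
    ∫ x : ℝ, (if ⌊x * s⌋ ∈ S then F ⌊x * s⌋ else 0) = 1 / s * ∑ p ∈ S, F p := by
  have h1 : ∀ x : ℝ, (if ⌊x * s⌋ ∈ S then F ⌊x * s⌋ else 0) =
      ∑ p ∈ S, (Set.Ico (p / s) ((p + 1) / s)).indicator (fun _ => F p) x := by
    intro x
    rw [Finset.sum_congr rfl (g := fun p => if p = ⌊x * s⌋ then F p else 0) fun p _ => ?_]
    · rw [Finset.sum_ite_eq' S ⌊x * s⌋ F]
    · rw [Set.indicator_apply]
      refine if_congr ?_ rfl rfl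
      rw [Set.mem_Ico, div_le_iff₀ hs, lt_div_iff₀ hs, eq_comm, Int.floor_eq_iff]
  simp_rw [h1]
  rw [MeasureTheory.integral_finsetSum, Finset.mul_sum]
  · refine Finset.sum_congr rfl fun p _ => ?_
    rw [MeasureTheory.integral_indicator_const _ measurableSet_Ico, Real.volume_real_Ico_of_le
      (by gcongr; linarith), smul_eq_mul]
    ring
  · intro p _
    exact (MeasureTheory.integrable_indicator_iff measurableSet_Ico).mpr
      (MeasureTheory.integrableOn_const (by simp))

theorem abs_floor_mul_div_sub_le (x : ℝ) {s : ℝ} (hs : 0 < s) :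
    |(⌊x * s⌋ : ℝ) / s - x| ≤ 1 / s := by
  have h1 := Int.floor_le (x * s)
  have h2 := Int.lt_floor_add_one (x * s)
  rw [show (⌊x * s⌋ : ℝ) / s - x = (⌊x * s⌋ - x * s) / s by field_simp, abs_div, abs_of_pos hs]
  gcongr
  rw [abs_le]; constructor <;> linarith

theorem tendsto_sqrt_natCast : Tendsto (fun L : ℕ => √(L : ℝ)) atTop atTop :=
  Real.tendsto_sqrt_atTop.comp tendsto_natCast_atTop_atTop

theorem tendsto_floor_mul_sqrt_div (x : ℝ) :
    Tendsto (fun L : ℕ => (⌊x * √L⌋ : ℝ) / √L) atTop (𝓝 x) := by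
  rw [tendsto_iff_dist_tendsto_zero]
  refine squeeze_zero' (Eventually.of_forall fun _ => dist_nonneg) ?_
    (tendsto_const_nhds.div_atTop tendsto_sqrt_natCast (a := (1 : ℝ)))
  filter_upwards [tendsto_sqrt_natCast.eventually_gt_atTop 0] with L hL
  exact abs_floor_mul_div_sub_le x hL

/-- Dominated convergence for Riemann sums with mesh `1 / √L`. -/
theorem tendsto_riemann_sum {F : ℕ → ℤ → ℝ} {f : ℝ → ℝ} {C c : ℝ} (hc : 0 < c)
    (hF : ∀ L : ℕ, 0 < L → ∀ p : ℤ, |F L p| ≤ C * Real.exp (-c * (|(p : ℝ)| / √L)))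
    (hlim : ∀ x : ℝ, Tendsto (fun L : ℕ => F L ⌊x * √L⌋) atTop (𝓝 (f x))) :
    Tendsto (fun L : ℕ => 1 / √L * ∑ p ∈ Finset.Icc (-(L : ℤ)) L, F L p) atTop
      (𝓝 (∫ x, f x)) := by
  have hC : 0 ≤ C := by
    have := (abs_nonneg _).trans (hF 1 one_pos 0)
    simpa using this
  have h := MeasureTheory.tendsto_integral_filter_of_dominated_convergence
    (l := (atTop : Filter ℕ)) (μ := MeasureTheory.volume)
    (F := fun (L : ℕ) x => if ⌊x * √L⌋ ∈ Finset.Icc (-(L : ℤ)) L then F L ⌊x * √L⌋ else 0)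
    (f := f) (fun x => C * Real.exp c * Real.exp (-c * |x|)) ?_ ?_
    ((integrable_exp_neg_mul_abs hc).const_mul _) ?_
  · refine h.congr' ?_
    filter_upwards [eventually_gt_atTop 0] with L hL
    exact integral_floor_mul (Real.sqrt_pos.mpr (by exact_mod_cast hL)) _ _
  · refine Eventually.of_forall fun L => Measurable.aestronglyMeasurable ?_
    have h1 : Measurable fun n : ℤ => if n ∈ Finset.Icc (-(L : ℤ)) L then F L n else 0 :=
      measurable_from_top
    exact h1.comp (Int.measurable_floor.comp (measurable_id.mul_const _))
  · filter_upwards [eventually_gt_atTop 0] with L hL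
    refine Eventually.of_forall fun x => ?_
    have hL1 : (1 : ℝ) ≤ L := by exact_mod_cast hL
    have hs1 : 1 ≤ √(L : ℝ) := Real.one_le_sqrt.mpr hL1
    have hs : 0 < √(L : ℝ) := by linarith
    have h2 : |F L ⌊x * √L⌋| ≤ C * Real.exp c * Real.exp (-c * |x|) := by
      refine (hF L hL _).trans ?_
      rw [mul_assoc, ← Real.exp_add]
      gcongr
      -- rounding moves the rescaled point by at most `1`
      have h3 := abs_floor_mul_div_sub_le x hs
      have h4 : 1 / √(L : ℝ) ≤ 1 := (div_le_one hs).mpr hs1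
      have h5 := abs_sub_abs_le_abs_sub x ((⌊x * √L⌋ : ℝ) / √L)
      rw [abs_sub_comm] at h5
      rw [abs_div, abs_of_pos hs] at h5
      nlinarith
    rw [Real.norm_eq_abs]
    split_ifs
    · exact h2
    · rw [abs_zero]; exact (abs_nonneg _).trans h2
  · refine Eventually.of_forall fun x => (hlim x).congr' ?_
    filter_upwards [tendsto_sqrt_natCast.eventually_ge_atTop (|x| + 1)] with L hL
    have h0 := abs_nonneg x
    have hs : 0 < √(L : ℝ) := by linarith
    have h1 := abs_floor_mul_div_sub_le x hs
    have hL2 : √(L : ℝ) * √L = L := Real.mul_self_sqrt (Nat.cast_nonneg _)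
    have h2 : 1 / √(L : ℝ) ≤ 1 := (div_le_one hs).mpr (by linarith)
    have h3 : |(⌊x * √L⌋ : ℝ) / √L| ≤ √L := by
      have := abs_sub_abs_le_abs_sub ((⌊x * √L⌋ : ℝ) / √L) x
      linarith
    rw [abs_div, abs_of_pos hs, div_le_iff₀ hs, hL2] at h3
    rw [if_pos]
    rw [Finset.mem_Icc, ← abs_le]
    exact_mod_cast h3

theorem integral_gaussDensity : ∫ x, gaussDensity x = 1 := by
  have := Real.pi_pos
  unfold gaussDensity
  rw [MeasureTheory.integral_const_mul, integral_gaussian, ← Real.sqrt_mul (by positivity),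
    show 3 / (4 * Real.pi) * (Real.pi / (3 / 4)) = 1 by field_simp, Real.sqrt_one]

theorem integrable_gaussDensity : MeasureTheory.Integrable gaussDensity :=
  (integrable_exp_neg_mul_sq (by norm_num)).const_mul _

theorem integrable_sq_mul_gaussDensity :
    MeasureTheory.Integrable fun x => x ^ 2 * gaussDensity x := by
  have := (integrable_rpow_mul_exp_neg_mul_sq (b := 3 / 4) (by norm_num) (s := 2)
    (by norm_num)).const_mul √(3 / (4 * Real.pi))
  refine this.congr (Eventually.of_forall fun x => ?_)
  simp only [Real.rpow_two, gaussDensity]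
  ring

theorem integral_sq_mul_gaussDensity : ∫ x, x ^ 2 * gaussDensity x = 2 / 3 := by
  have hπ := Real.pi_pos
  have h := ProbabilityTheory.variance_fun_id_gaussianReal (μ := 0) (v := 2 / 3)
  rw [ProbabilityTheory.variance_eq_integral (by fun_prop),
    ProbabilityTheory.integral_id_gaussianReal,
    ProbabilityTheory.integral_gaussianReal_eq_integral_smul (by norm_num)] at h
  have h2 : ((2 / 3 : NNReal) : ℝ) = 2 / 3 := by norm_num
  rw [h2] at h
  rw [← h]
  congr 1
  ext x
  rw [ProbabilityTheory.gaussianPDFReal, gaussDensity, h2, smul_eq_mul, ← Real.sqrt_inv, sub_zero]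
  rw [mul_comm (x ^ 2)]
  congr 3
  · field_simp; norm_num
  · ring

/-! ### The Gaussian weights -/

/-- The normalization of the discretized Gaussian density: `√L * gaussWeight L p` is this factor
times `exp (-(3 / 4) * x ^ 2)` at `x = p / √L`. -/
noncomputable def gaussNorm (L : ℕ) : ℝ :=
  √L / ∑ q ∈ Finset.Icc (-(L : ℤ)) L, Real.exp (-(3 / 4) * (q : ℝ) ^ 2 / L)

theorem gaussPrefactor_pos : 0 < √(3 / (4 * Real.pi)) := by
  have := Real.pi_pos
  positivity

theorem exp_sq_div_eq (L : ℕ) (p : ℤ) : Real.exp (-(3 / 4) * (p : ℝ) ^ 2 / L) =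
    Real.exp (-(3 / 4) * (p / √L : ℝ) ^ 2) := by
  rw [div_pow, Real.sq_sqrt (Nat.cast_nonneg _)]; congr 1; ring

theorem exp_sq_le (x : ℝ) :
    Real.exp (-(3 / 4) * x ^ 2) ≤ Real.exp 1 * Real.exp (-(1 / 2) * |x|) := by
  rw [← Real.exp_add, ← sq_abs]
  exact Real.exp_le_exp.mpr (by nlinarith [sq_nonneg (|x| - 1 / 3)])

theorem sqrt_mul_gaussWeight (L : ℕ) (p : ℤ) :
    √L * gaussWeight L p = gaussNorm L * Real.exp (-(3 / 4) * (p / √L : ℝ) ^ 2) := by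
  rw [gaussWeight, gaussNorm, ← exp_sq_div_eq]; ring

theorem gaussNorm_nonneg (L : ℕ) : 0 ≤ gaussNorm L :=
  div_nonneg (Real.sqrt_nonneg _) (Finset.sum_nonneg fun _ _ => (Real.exp_pos _).le)

theorem tendsto_gaussNorm : Tendsto gaussNorm atTop (𝓝 √(3 / (4 * Real.pi))) := by
  have hπ := Real.pi_pos
  have h := tendsto_riemann_sum (F := fun L p => Real.exp (-(3 / 4) * (p : ℝ) ^ 2 / L))
    (f := fun x => Real.exp (-(3 / 4) * x ^ 2)) (C := Real.exp 1) (c := 1 / 2) (by norm_num)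
    (fun L hL p => by
      rw [abs_of_pos (Real.exp_pos _), exp_sq_div_eq,
        ← abs_of_nonneg (Real.sqrt_nonneg (L : ℝ)), ← abs_div, abs_of_nonneg (Real.sqrt_nonneg _)]
      exact exp_sq_le _)
    (fun x => by
      simp_rw [exp_sq_div_eq]
      exact ((show Continuous fun x : ℝ => Real.exp (-(3 / 4) * x ^ 2) by fun_prop).tendsto x).comp
        (tendsto_floor_mul_sqrt_div x))
  rw [integral_gaussian] at h
  have h2 := h.inv₀ (by positivity)
  rw [← Real.sqrt_inv, show (Real.pi / (3 / 4))⁻¹ = 3 / (4 * Real.pi) by field_simp] at h2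
  refine h2.congr fun L => ?_
  rw [gaussNorm, one_div, mul_inv, inv_inv, ← div_eq_mul_inv]

/-! ### Gaussian asymptotics of the weights -/

theorem tendsto_sqrt_mul_walkProb (x : ℝ) :
    Tendsto (fun L : ℕ => √L * walkProb L ⌊x * √L⌋) atTop (𝓝 (gaussDensity x)) := by
  have h1 := (continuous_gaussDensity.tendsto x).comp (tendsto_floor_mul_sqrt_div x)
  have h2 : Tendsto (fun L : ℕ => √L * walkProb L ⌊x * √L⌋ - gaussDensity (⌊x * √L⌋ / √L)) atTop
      (𝓝 0) := by
    refine squeeze_zero_norm' ?_ tendsto_charError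
    filter_upwards [eventually_gt_atTop 0] with L hL
    exact abs_sqrt_mul_walkProb_sub_le hL _
  simpa using h2.add h1

theorem tendsto_traceNorm_sub :
    Tendsto (fun L : ℕ => traceNorm (walkDiagonal L (walkProb L) -
      walkDiagonal L (gaussWeight L))) atTop (𝓝 0) := by
  obtain ⟨C, hC1, hC⟩ := exists_walkProb_le
  obtain ⟨K, hK⟩ := tendsto_gaussNorm.bddAbove_range
  have hK' : ∀ L, gaussNorm L ≤ K := fun L => hK ⟨L, rfl⟩
  have h := tendsto_riemann_sum (F := fun L p => |√L * walkProb L p - √L * gaussWeight L p|)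
    (f := fun _ => 0) (C := C + K * Real.exp 1) (c := 1 / 2) (by norm_num)
    (fun L hL p => by
      have h0 := exp_sq_le (p / √L)
      rw [abs_div, abs_of_nonneg (Real.sqrt_nonneg _)] at h0
      have h1 : 0 ≤ √(L : ℝ) * walkProb L p := mul_nonneg (Real.sqrt_nonneg _) (walkProb_nonneg _ _)
      have h2 : 0 ≤ √(L : ℝ) * gaussWeight L p := by
        rw [sqrt_mul_gaussWeight]; exact mul_nonneg (gaussNorm_nonneg _) (Real.exp_pos _).le
      have h3 : √(L : ℝ) * gaussWeight L p ≤
          K * (Real.exp 1 * Real.exp (-(1 / 2) * (|(p : ℝ)| / √L))) := by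
        rw [sqrt_mul_gaussWeight]
        exact mul_le_mul (hK' L) h0 (Real.exp_pos _).le ((gaussNorm_nonneg L).trans (hK' L))
      rw [abs_abs]
      refine (abs_sub _ _).trans ?_
      rw [abs_of_nonneg h1, abs_of_nonneg h2]
      linarith [hC L hL p])
    (fun x => by
      have h1 := tendsto_gaussNorm.mul (((show Continuous fun x : ℝ =>
        Real.exp (-(3 / 4) * x ^ 2) by fun_prop).tendsto x).comp (tendsto_floor_mul_sqrt_div x))
      have h2 := ((tendsto_sqrt_mul_walkProb x).sub h1).abs
      rw [gaussDensity, sub_self, abs_zero] at h2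
      refine h2.congr fun L => ?_
      rw [sqrt_mul_gaussWeight]
      rfl)
  rw [MeasureTheory.integral_zero] at h
  refine h.congr' ?_
  filter_upwards [eventually_gt_atTop 0] with L hL
  have hs : 0 < √(L : ℝ) := Real.sqrt_pos.mpr (by exact_mod_cast hL)
  rw [walkDiagonal_sub, traceNorm_walkDiagonal, Finset.mul_sum]
  refine Finset.sum_congr rfl fun p _ => ?_
  rw [← mul_sub, abs_mul, abs_of_pos hs, ← mul_assoc, one_div, inv_mul_cancel₀ hs.ne', one_mul]

theorem eventually_abs_div_gaussWeight_sub_one_le (R ε : ℝ) (hε : 0 < ε) :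
    ∀ᶠ L : ℕ in atTop, ∀ p : ℤ, |(p : ℝ)| ≤ R * √L →
      |walkProb L p / gaussWeight L p - 1| ≤ ε := by
  set A := √(3 / (4 * Real.pi)) with hA
  have hA0 : 0 < A := gaussPrefactor_pos
  set m := Real.exp (-(3 / 4) * R ^ 2) with hm
  have hm0 : 0 < m := Real.exp_pos _
  have h1 : Tendsto (fun L => charError L + |A - gaussNorm L|) atTop (𝓝 0) := by
    have := tendsto_charError.add (tendsto_gaussNorm.const_sub A).abs
    rwa [← hA, sub_self, abs_zero, add_zero] at this
  filter_upwards [eventually_gt_atTop 0, tendsto_gaussNorm.eventually (lt_mem_nhds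
    (half_lt_self hA0)), h1.eventually (gt_mem_nhds (show 0 < ε * (A / 2 * m) by positivity))]
    with L hL h2 h3 p hp
  have hs : 0 < √(L : ℝ) := Real.sqrt_pos.mpr (by exact_mod_cast hL)
  set e := Real.exp (-(3 / 4) * (p / √L : ℝ) ^ 2) with he
  have he1 : e ≤ 1 := Real.exp_le_one_iff.mpr (by nlinarith [sq_nonneg ((p : ℝ) / √L)])
  have he0 : 0 < e := Real.exp_pos _
  have hme : m ≤ e := by
    refine Real.exp_le_exp.mpr ?_
    have : |(p : ℝ) / √L| ≤ R := by rwa [abs_div, abs_of_pos hs, div_le_iff₀ hs]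
    have : ((p : ℝ) / √L) ^ 2 ≤ R ^ 2 := by rw [← sq_abs]; gcongr
    linarith
  have h4 := abs_sqrt_mul_walkProb_sub_le hL p
  rw [gaussDensity, ← hA, ← he] at h4
  have h5 : walkProb L p / gaussWeight L p - 1 =
      (√L * walkProb L p - gaussNorm L * e) / (gaussNorm L * e) := by
    have hg : gaussNorm L * e ≠ 0 := by
      have : 0 < gaussNorm L := by linarith
      positivity
    rw [sub_div, div_self hg, ← sqrt_mul_gaussWeight, mul_div_mul_left _ _ hs.ne']
  have h6 : A / 2 * m ≤ gaussNorm L * e := mul_le_mul h2.le hme hm0.le (by linarith)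
  have h7 : 0 < gaussNorm L * e := lt_of_lt_of_le (by positivity) h6
  rw [h5, abs_div, abs_of_pos h7, div_le_iff₀ h7]
  calc |√L * walkProb L p - gaussNorm L * e|
      ≤ |√L * walkProb L p - A * e| + |A * e - gaussNorm L * e| := abs_sub_le _ _ _
    _ ≤ charError L + |A - gaussNorm L| := by
        rw [← sub_mul, abs_mul, abs_of_pos he0]
        exact add_le_add h4 (mul_le_of_le_one_right (abs_nonneg _) he1)
    _ ≤ ε * (A / 2 * m) := h3.le
    _ ≤ ε * (gaussNorm L * e) := by gcongr

/-! ### Entropies -/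

theorem walkProb_pos {L : ℕ} {p : ℤ} (hp : |p| ≤ (L : ℤ)) : 0 < walkProb L p := by
  have : (0 : ℝ) < walkCount L p := by exact_mod_cast walkCount_pos hp
  unfold walkProb; positivity

theorem abs_mul_log_le {u : ℝ} (hu : 0 ≤ u) : |u * Real.log u| ≤ 2 * (u + 1) * √u := by
  rcases eq_or_lt_of_le hu with rfl | hu'
  · simp
  have hs : 0 < √u := Real.sqrt_pos.mpr hu'
  have hsq : √u * √u = u := Real.mul_self_sqrt hu
  have h1 : Real.log u = 2 * Real.log √u := by rw [Real.log_sqrt hu]; ring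
  have h2 := Real.log_le_sub_one_of_pos hs
  have h3 := Real.one_sub_inv_le_log_of_pos hs
  have h4 : u * (√u)⁻¹ = √u := by rw [← div_eq_mul_inv, Real.div_sqrt]
  rw [h1, abs_le]
  constructor
  · nlinarith [mul_le_mul_of_nonneg_left h3 hu, mul_nonneg hu hs.le]
  · nlinarith [mul_le_mul_of_nonneg_left h2 hu, mul_nonneg hu hs.le]

theorem log_two_mul_sqrt_pi_div_three :
    Real.log (2 * √(Real.pi / 3)) = 1 / 2 * Real.log (4 * Real.pi / 3) := by
  have hπ := Real.pi_pos
  have h : 2 * √(Real.pi / 3) = √(4 * Real.pi / 3) := by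
    rw [show 4 * Real.pi / 3 = 2 ^ 2 * (Real.pi / 3) by ring, Real.sqrt_mul (by norm_num),
      Real.sqrt_sq (by norm_num)]
  rw [h, Real.log_sqrt (by positivity)]; ring

theorem log_gaussPrefactor :
    Real.log √(3 / (4 * Real.pi)) = -(1 / 2 * Real.log (4 * Real.pi / 3)) := by
  have hπ := Real.pi_pos
  rw [Real.log_sqrt (by positivity), ← inv_div (4 * Real.pi), Real.log_inv]; ring

/-- The differential entropy of the Gaussian density. -/
theorem integral_negMulLog_gaussDensity :
    ∫ x, Real.negMulLog (gaussDensity x) = Real.log (2 * √(Real.pi / 3)) + 1 / 2 := by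
  have h : ∀ x, Real.negMulLog (gaussDensity x) = 1 / 2 * Real.log (4 * Real.pi / 3) *
      gaussDensity x + 3 / 4 * (x ^ 2 * gaussDensity x) := by
    intro x
    have h1 : Real.log (gaussDensity x) = -(1 / 2 * Real.log (4 * Real.pi / 3)) +
        -(3 / 4) * x ^ 2 := by
      rw [gaussDensity, Real.log_mul gaussPrefactor_pos.ne' (Real.exp_pos _).ne', Real.log_exp,
        log_gaussPrefactor]
    rw [Real.negMulLog, h1]; ring
  simp_rw [h]
  rw [MeasureTheory.integral_add (integrable_gaussDensity.const_mul _)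
    (integrable_sq_mul_gaussDensity.const_mul _), MeasureTheory.integral_const_mul,
    MeasureTheory.integral_const_mul, integral_gaussDensity, integral_sq_mul_gaussDensity,
    log_two_mul_sqrt_pi_div_three]
  norm_num

theorem log_integral_gaussDensity_rpow {κ : ℝ} (hκ : 0 < κ) :
    0 < ∫ x, gaussDensity x ^ κ ∧ Real.log (∫ x, gaussDensity x ^ κ) =
      (1 - κ) * Real.log (2 * √(Real.pi / 3)) - Real.log κ / 2 := by
  have hπ := Real.pi_pos
  have hA := gaussPrefactor_pos
  have h : ∀ x, gaussDensity x ^ κ =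
      √(3 / (4 * Real.pi)) ^ κ * Real.exp (-(3 / 4 * κ) * x ^ 2) := by
    intro x
    rw [gaussDensity, Real.mul_rpow hA.le (Real.exp_pos _).le, ← Real.exp_mul]
    congr 2; ring
  simp_rw [h]
  rw [MeasureTheory.integral_const_mul, integral_gaussian]
  have h2 : 0 < √(Real.pi / (3 / 4 * κ)) := Real.sqrt_pos.mpr (by positivity)
  refine ⟨by positivity, ?_⟩
  rw [Real.log_mul (Real.rpow_pos_of_pos hA _).ne' h2.ne', Real.log_rpow hA, log_gaussPrefactor,
    Real.log_sqrt (by positivity), show Real.pi / (3 / 4 * κ) = 4 * Real.pi / 3 / κ by field_simp,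
    Real.log_div (by positivity) hκ.ne', log_two_mul_sqrt_pi_div_three]
  ring

theorem vonNeumannEntropy_walkDiagonal (L : ℕ) :
    vonNeumannEntropy (walkDiagonal L (walkProb L)) =
      ∑ p ∈ Finset.Icc (-(L : ℤ)) L, Real.negMulLog (walkProb L p) := by
  rw [vonNeumannEntropy, trace_cfc_walkDiagonal L _ (by simp)]
  refine Finset.sum_congr rfl fun p _ => ?_
  rw [Real.negMulLog]; ring

theorem log_sqrt_natCast (L : ℕ) : Real.log √(L : ℝ) = 1 / 2 * Real.log L := by
  rw [Real.log_sqrt (Nat.cast_nonneg _)]; ring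

theorem tendsto_vonNeumannEntropy :
    Tendsto (fun L : ℕ => vonNeumannEntropy (walkDiagonal L (walkProb L)) -
      (1 / 2 * Real.log L + Real.log (2 * √(Real.pi / 3)) + 1 / 2)) atTop (𝓝 0) := by
  obtain ⟨C, hC1, hC⟩ := exists_walkProb_le
  have h := tendsto_riemann_sum (F := fun L p => Real.negMulLog (√L * walkProb L p))
    (f := fun x => Real.negMulLog (gaussDensity x)) (C := 2 * (C + 1) * √C) (c := 1 / 4)
    (by norm_num)
    (fun L hL p => by
      have h0 : 0 ≤ √(L : ℝ) * walkProb L p := mul_nonneg (Real.sqrt_nonneg _) (walkProb_nonneg _ _)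
      have h1 := hC L hL p
      have h2 : Real.exp (-(1 / 2) * (|(p : ℝ)| / √L)) ≤ 1 :=
        Real.exp_le_one_iff.mpr (by
          have : 0 ≤ |(p : ℝ)| / √L := by positivity
          linarith)
      have h3 : √L * walkProb L p ≤ C := h1.trans (mul_le_of_le_one_right (by linarith) h2)
      have h4 : √(√L * walkProb L p) ≤ √C * Real.exp (-(1 / 4) * (|(p : ℝ)| / √L)) := by
        refine (Real.sqrt_le_sqrt h1).trans_eq ?_
        rw [Real.sqrt_mul (by linarith), ← Real.exp_half]
        congr 2; ring
      rw [Real.negMulLog, neg_mul, abs_neg, mul_assoc (2 * (C + 1))]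
      refine (abs_mul_log_le h0).trans ?_
      gcongr)
    (fun x => (Real.continuous_negMulLog.tendsto _).comp (tendsto_sqrt_mul_walkProb x))
  have h2 := h.sub_const (Real.log (2 * √(Real.pi / 3)) + 1 / 2)
  rw [integral_negMulLog_gaussDensity, sub_self] at h2
  refine h2.congr' ?_
  filter_upwards [eventually_gt_atTop 0] with L hL
  have hs : 0 < √(L : ℝ) := Real.sqrt_pos.mpr (by exact_mod_cast hL)
  have h3 : 1 / √L * ∑ p ∈ Finset.Icc (-(L : ℤ)) L, Real.negMulLog (√L * walkProb L p) =
      ∑ p ∈ Finset.Icc (-(L : ℤ)) L, Real.negMulLog (walkProb L p) - 1 / 2 * Real.log L := by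
    have h4 : ∀ p, Real.negMulLog (√L * walkProb L p) =
        √L * (Real.negMulLog (walkProb L p) - walkProb L p * (1 / 2 * Real.log L)) := by
      intro p
      rw [Real.negMulLog_mul, ← log_sqrt_natCast, Real.negMulLog, Real.negMulLog]
      ring
    simp_rw [h4]
    rw [← Finset.mul_sum, Finset.sum_sub_distrib, ← Finset.sum_mul, sum_walkProb, ← mul_assoc,
      one_div, inv_mul_cancel₀ hs.ne', one_mul, one_mul]
  rw [h3, vonNeumannEntropy_walkDiagonal]
  ring

theorem renyiEntropy_walkDiagonal (L : ℕ) {κ : ℝ} (hκ : 0 < κ) :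
    renyiEntropy κ (walkDiagonal L (walkProb L)) =
      1 / (1 - κ) * Real.log (∑ p ∈ Finset.Icc (-(L : ℤ)) L, walkProb L p ^ κ) := by
  rw [renyiEntropy, trace_cfc_walkDiagonal L _ (f := fun x => x ^ κ) (Real.zero_rpow hκ.ne')]

theorem sum_walkProb_rpow_pos (L : ℕ) (κ : ℝ) :
    0 < ∑ p ∈ Finset.Icc (-(L : ℤ)) L, walkProb L p ^ κ :=
  Finset.sum_pos (fun p hp => Real.rpow_pos_of_pos
    (walkProb_pos (abs_le.mpr (Finset.mem_Icc.mp hp))) _) ⟨0, by simp⟩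

theorem tendsto_renyiEntropy {κ : ℝ} (hκ : 0 < κ) (hκ1 : κ ≠ 1) :
    Tendsto (fun L : ℕ => renyiEntropy κ (walkDiagonal L (walkProb L)) -
      (1 / 2 * Real.log L + Real.log (2 * √(Real.pi / 3)) - Real.log κ / (2 * (1 - κ))))
      atTop (𝓝 0) := by
  obtain ⟨C, hC1, hC⟩ := exists_walkProb_le
  have h1κ : 1 - κ ≠ 0 := sub_ne_zero.mpr hκ1.symm
  have h := tendsto_riemann_sum (F := fun L p => (√L * walkProb L p) ^ κ)
    (f := fun x => gaussDensity x ^ κ) (C := C ^ κ) (c := κ / 2) (by positivity)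
    (fun L hL p => by
      have h0 : 0 ≤ √(L : ℝ) * walkProb L p := mul_nonneg (Real.sqrt_nonneg _) (walkProb_nonneg _ _)
      rw [abs_of_nonneg (Real.rpow_nonneg h0 _)]
      refine (Real.rpow_le_rpow h0 (hC L hL p) hκ.le).trans_eq ?_
      rw [Real.mul_rpow (by linarith) (Real.exp_pos _).le, ← Real.exp_mul]
      congr 2; ring)
    (fun x => (tendsto_sqrt_mul_walkProb x).rpow_const (Or.inr hκ.le))
  obtain ⟨hpos, hlog⟩ := log_integral_gaussDensity_rpow hκ
  have h2 := ((h.log hpos.ne').const_mul (1 / (1 - κ))).sub_const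
    (Real.log (2 * √(Real.pi / 3)) - Real.log κ / (2 * (1 - κ)))
  rw [hlog, show 1 / (1 - κ) * ((1 - κ) * Real.log (2 * √(Real.pi / 3)) - Real.log κ / 2) -
    (Real.log (2 * √(Real.pi / 3)) - Real.log κ / (2 * (1 - κ))) = 0 by field_simp; ring] at h2
  refine h2.congr' ?_
  filter_upwards [eventually_gt_atTop 0] with L hL
  have hs : 0 < √(L : ℝ) := Real.sqrt_pos.mpr (by exact_mod_cast hL)
  rw [renyiEntropy_walkDiagonal L hκ]
  have hsum := sum_walkProb_rpow_pos L κ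
  have h3 : Real.log (1 / √L * ∑ p ∈ Finset.Icc (-(L : ℤ)) L, (√L * walkProb L p) ^ κ) =
      Real.log (∑ p ∈ Finset.Icc (-(L : ℤ)) L, walkProb L p ^ κ) -
        (1 - κ) * (1 / 2 * Real.log L) := by
    simp_rw [fun p => Real.mul_rpow hs.le (walkProb_nonneg L p) (z := κ)]
    rw [← Finset.mul_sum, Real.log_mul (by positivity) (by positivity),
      Real.log_mul (by positivity) hsum.ne', Real.log_rpow hs, one_div, Real.log_inv,
      log_sqrt_natCast]
    ring
  rw [h3]
  field_simp
  ring

end MotzkinChain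

theorem mainTheorem5 :
    ∃ (ρ : (L : ℕ) → Matrix (MotzkinChain.Config L) (MotzkinChain.Config L) ℂ)
      (lam : ℕ → ℤ → ℝ),
      -- the thermodynamic limit of the reduced density matrix, for a fixed block length
      (∀ L : ℕ, Tendsto (fun b : ℕ => MotzkinChain.blockDensity b L) atTop (𝓝 (ρ L))) ∧
      -- it is diagonal in the vectors `|C_{L,p}⟩`, with positive weights
      (∀ L : ℕ, (∀ p : ℤ, |p| ≤ (L : ℤ) → 0 < lam L p) ∧
        ρ L = MotzkinChain.walkDiagonal L (lam L)) ∧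
      -- the weights are asymptotically Gaussian: in trace norm, and pointwise for `p = O(√L)`
      Tendsto (fun L : ℕ => MotzkinChain.traceNorm
        (ρ L - MotzkinChain.walkDiagonal L (MotzkinChain.gaussWeight L))) atTop (𝓝 0) ∧
      (∀ R : ℝ, ∀ ε : ℝ, 0 < ε → ∀ᶠ L : ℕ in atTop, ∀ p : ℤ, |(p : ℝ)| ≤ R * Real.sqrt L →
        |lam L p / MotzkinChain.gaussWeight L p - 1| ≤ ε) ∧
      -- the Schmidt rank is `2L + 1`: for the limit, and as the number of
      -- non-vanishing eigenvalues (with multiplicity) in a long finite chain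
      (∀ L : ℕ, (ρ L).rank = 2 * L + 1) ∧
      (∀ L : ℕ, ∃ δ : ℝ, 0 < δ ∧ ∀ ε : ℝ, 0 < ε → ε < δ → ∀ᶠ b : ℕ in atTop,
        Nat.card {w : MotzkinChain.Config L //
          ε < (MotzkinChain.blockDensity_isHermitian b L).eigenvalues w} = 2 * L + 1) ∧
      -- the von Neumann entropy: first the chain length, then `L`, goes to infinity
      (∀ L : ℕ, Tendsto (fun b : ℕ => MotzkinChain.vonNeumannEntropy
        (MotzkinChain.blockDensity b L)) atTop (𝓝 (MotzkinChain.vonNeumannEntropy (ρ L)))) ∧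
      Tendsto (fun L : ℕ => MotzkinChain.vonNeumannEntropy (ρ L) -
        (1 / 2 * Real.log L + Real.log (2 * Real.sqrt (Real.pi / 3)) + 1 / 2)) atTop (𝓝 0) ∧
      -- the Rényi entropies, in the same iterated limit
      ∀ κ : ℝ, 0 < κ → κ ≠ 1 →
        (∀ L : ℕ, Tendsto (fun b : ℕ => MotzkinChain.renyiEntropy κ
          (MotzkinChain.blockDensity b L)) atTop (𝓝 (MotzkinChain.renyiEntropy κ (ρ L)))) ∧
        Tendsto (fun L : ℕ => MotzkinChain.renyiEntropy κ (ρ L) -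
          (1 / 2 * Real.log L + Real.log (2 * Real.sqrt (Real.pi / 3)) -
            Real.log κ / (2 * (1 - κ)))) atTop (𝓝 0) := by
  refine ⟨fun L => MotzkinChain.walkDiagonal L (MotzkinChain.walkProb L), MotzkinChain.walkProb,
    MotzkinChain.tendsto_blockDensity, fun L => ⟨fun p hp => MotzkinChain.walkProb_pos hp, rfl⟩,
    MotzkinChain.tendsto_traceNorm_sub,
    MotzkinChain.eventually_abs_div_gaussWeight_sub_one_le,
    fun L => MotzkinChain.rank_walkDiagonal L _ fun p hp => MotzkinChain.walkProb_pos hp,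
    fun L => ?_, fun L => ?_, MotzkinChain.tendsto_vonNeumannEntropy,
    fun κ hκ hκ1 => ⟨fun L => ?_, MotzkinChain.tendsto_renyiEntropy hκ hκ1⟩⟩
  · -- the smallest nonzero eigenvalue is the weight of a single path
    refine ⟨1 / 3 ^ L, by positivity, fun ε hε hεδ => ?_⟩
    refine MotzkinChain.eventually_card_eigenvalues_gt L _
      (fun b => MotzkinChain.blockDensity_isHermitian b L) (MotzkinChain.tendsto_blockDensity L)
      (fun p hp => ?_) hε hεδ
    have h : (1 : ℝ) ≤ MotzkinChain.walkCount L p := by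
      exact_mod_cast MotzkinChain.walkCount_pos hp
    rw [MotzkinChain.walkProb]
    gcongr
  · refine MotzkinChain.tendsto_trace_cfc (fun b => MotzkinChain.blockDensity_isHermitian b L)
      (MotzkinChain.walkDiagonal_isHermitian L _) (MotzkinChain.tendsto_blockDensity L) ?_
    exact Real.continuous_mul_log.neg
  · have h := MotzkinChain.tendsto_trace_cfc
      (fun b => MotzkinChain.blockDensity_isHermitian b L)
      (MotzkinChain.walkDiagonal_isHermitian L _) (MotzkinChain.tendsto_blockDensity L)
      (Real.continuous_rpow_const hκ.le)
    refine (h.log ?_).const_mul _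
    rw [MotzkinChain.trace_cfc_walkDiagonal L _ (f := fun x => x ^ κ) (Real.zero_rpow hκ.ne')]
    exact (MotzkinChain.sum_walkProb_rpow_pos L κ).ne'
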